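/- **Notation.** Let $B^2=\{(x,y)\in\mathbb R^2: x^2+y^2\le 1\}$, $\mu\ge 0$, $W_\mu(x,y)=(1-x^2-y^2)^{\mu-1/2}$ and $a_\mu=(\mu+\tfrac12)/\pi=1/\int_{B^2}W_\mu\,dx\,dy$. Let $L^2(W_\mu;B^2)$ carry the inner product $\langle P,Q\rangle_\mu=a_\mu\int_{B^2}PQ\,W_\mu\,dx\,dy$, let $\mathcal V_k^2(W_\mu)$ be the space of real polynomials in two variables of total degree at most $k$ that are orthogonal to all polynomials of total degree less than $k$, and let $\operatorname{proj}_k^\mu$ be the orthogonal projection of $L^2(W_\mu;B^2)$ onto $\mathcal V_k^2(W_\mu)$; thus $\operatorname{proj}_k^\mu f$ is a polynomial. The attenuated Radon projection of $f$ is $$\mathcal R_\theta^\mu(f;t)=\int_{-\sqrt{1-t^2}}^{\sqrt{1-t^2}} (fW_\mu)(t\cos\theta-s\sin\theta,\;t\sin\theta+s\cos\theta)\,ds,\qquad -1\le t\le 1 .$$ Let $C_k^{\lambda}$ be the Gegenbauer polynomials, in the standard normalization $C_k^\lambda(1)=(2\lambda)_k/k!$, and let $p_l^{(\alpha,\beta)}$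 be the Jacobi polynomials, normalized by $c_{\alpha,\beta}\int_{-1}^1 \big(p_l^{(\alpha,\beta)}(t)\big)^2(1-t)^\alpha(1+t)^\beta dt=1$, where $c_{\alpha,\beta}\int_{-1}^1(1-t)^\alpha(1+t)^\beta dt=1$. For $0\le 2l\le k$ put $$h_{l,k}=\left(\frac{\Gamma(k-2l+\mu+\frac32)}{\Gamma(\mu+\frac32)\,\Gamma(k-2l+1)}\right)^{1/2},\qquad H_{l,k}^\mu=h_{l,k}\,p_l^{(\mu-\frac12,\,k-2l)}(1),\qquad \lambda_{l,k}^\mu=[H_{l,k}^\mu]^{-2},$$ and $d_{l,k}=\frac12$ if $2l<k$, $d_{l,k}=1$ if $2l=k$. In polar coordinates $x=r\cos\phi$, $y=r\sin\phi$ let $$P_{l,\varepsilon}^k(x,y)=d_{l,k}^{-1/2}\,h_{l,k}\,p_l^{(\mu-\frac12,\,k-2l)}(2r^2-1)\,r^{k-2l}\,S_{k-2l,\varepsilon}(\phi),\qquad S_{j,0}(\phi)=\cos j\phi,\quad S_{j,1}(\phi)=\sin j\phi,$$ for $0\le 2l\le k$ if $\varepsilon=0$ and for $0\le 2l\le k-1$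 if $\varepsilon=1$ (this is an orthonormal basis of $\mathcal V_k^2(W_\mu)$). Finally let $$D_k^{\mu+1/2}(\xi,t;x,y)=\frac{k+\mu+\frac12}{\mu+\frac12}\,C_k^{\mu+1/2}(t)\sum_{l,\varepsilon}\lambda_{l,k}^\mu\,P_{l,\varepsilon}^k(\cos\xi,\sin\xi)\,P_{l,\varepsilon}^k(x,y),$$ the sum extending over all admissible pairs $(l,\varepsilon)$. **Theorem.** Let $\mu\ge0$, let $m,k\ge 0$ be integers with $k\le 2m$, let $f\in L^2(W_\mu;B^2)$ be real-valued, and let $\phi_\nu=\frac{2\nu\pi}{2m+1}$ for $0\le\nu\le 2m$. Then, for all $(x,y)\in\mathbb R^2$, $$\operatorname{proj}_k^\mu f(x,y)=\frac1{2m+1}\sum_{\nu=0}^{2m}a_\mu\int_{-1}^1\mathcal R_{\phi_\nu}^\mu(f;t)\,D_k^{\mu+1/2}(\phi_\nu,t;x,y)\,dt .$$ The integrals converge absolutely: for every angle $\theta$, the integral defining $\mathcal R_\theta^\mu(f;t)$ does so for almost every $t\in[-1,1]$, and $t\mapsto\mathcal R_\theta^\mu(f;t)\,D_k^{\mu+1/2}(\theta,t;x,y)$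 is integrable on $[-1,1]$ for all $(x,y)$. -/

import Mathlib

open MeasureTheory

noncomputable section

namespace AttenuatedRadon

/-- The closed unit disk `B²` of the plane. -/
def disk : Set (ℝ × ℝ) := {p | p.1 ^ 2 + p.2 ^ 2 ≤ 1}

/-- The weight `W_μ(x, y) = (1 - x² - y²)^(μ - 1/2)`. -/
def weight (μ : ℝ) (p : ℝ × ℝ) : ℝ := (1 - p.1 ^ 2 - p.2 ^ 2) ^ (μ - 1 / 2)

/-- `a_μ = (μ + 1/2) / π`, the normalization constant of `W_μ` on the disk. -/
def aConst (μ : ℝ) : ℝ := (μ + 1 / 2) / Real.pi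

/-- The measure `a_μ W_μ(x, y) dx dy` on the disk; the inner product of its `L²` space is
`⟨P, Q⟩_μ = a_μ ∫_{B²} P Q W_μ`. -/
def diskMeasure (μ : ℝ) : Measure (ℝ × ℝ) :=
  (volume.restrict disk).withDensity fun p => ENNReal.ofReal (aConst μ * weight μ p)

/-- The function on the plane given by a polynomial in two variables. -/
def polyFun (P : MvPolynomial (Fin 2) ℝ) (p : ℝ × ℝ) : ℝ := MvPolynomial.eval ![p.1, p.2] P

/-- `Π_n²` inside `L²(W_μ; B²)`: the classes of the polynomials of total degree at most `n`. -/
def polyL2 (μ : ℝ) (n : ℕ) : Submodule ℝ (Lp ℝ 2 (diskMeasure μ)) where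
  carrier := {g | ∃ P : MvPolynomial (Fin 2) ℝ,
    P ∈ MvPolynomial.restrictTotalDegree (Fin 2) ℝ n ∧ g =ᵐ[diskMeasure μ] polyFun P}
  zero_mem' := by
    refine ⟨0, Submodule.zero_mem _, ?_⟩
    filter_upwards [Lp.coeFn_zero ℝ 2 (diskMeasure μ)] with p hp
    rw [hp]
    simp [polyFun]
  add_mem' := by
    rintro g h ⟨P, hP, hgP⟩ ⟨Q, hQ, hhQ⟩
    refine ⟨P + Q, Submodule.add_mem _ hP hQ, ?_⟩
    filter_upwards [Lp.coeFn_add g h, hgP, hhQ] with p h1 h2 h3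
    simp only [polyFun] at h2 h3
    rw [h1, Pi.add_apply, h2, h3]
    simp [polyFun]
  smul_mem' := by
    rintro c g ⟨P, hP, hgP⟩
    refine ⟨c • P, Submodule.smul_mem _ c hP, ?_⟩
    filter_upwards [Lp.coeFn_smul c g, hgP] with p h1 h2
    simp only [polyFun] at h2
    rw [h1, Pi.smul_apply, h2]
    simp [polyFun, MvPolynomial.smul_eval]

instance polyL2_finiteDimensional (μ : ℝ) (n : ℕ) : FiniteDimensional ℝ (polyL2 μ n) := by
  have hadd : ∀ P Q, polyFun (P + Q) = polyFun P + polyFun Q := fun P Q => by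
    funext p; simp [polyFun]
  have hsmul : ∀ (c : ℝ) P, polyFun (c • P) = c • polyFun P := fun c P => by
    funext p; simp [polyFun, MvPolynomial.smul_eval]
  let V : Submodule ℝ (MvPolynomial (Fin 2) ℝ) :=
    { carrier := {P | P ∈ MvPolynomial.restrictTotalDegree (Fin 2) ℝ n ∧
        MemLp (polyFun P) 2 (diskMeasure μ)}
      zero_mem' := ⟨Submodule.zero_mem _, by
        have : polyFun 0 = 0 := by funext p; simp [polyFun]
        rw [this]; exact MemLp.zero⟩
      add_mem' := fun hP hQ => ⟨Submodule.add_mem _ hP.1 hQ.1, by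
        rw [hadd]; exact hP.2.add hQ.2⟩
      smul_mem' := fun c P hP => ⟨Submodule.smul_mem _ c hP.1, by
        rw [hsmul]; exact hP.2.const_smul c⟩ }
  have hV : FiniteDimensional ℝ V := Submodule.finiteDimensional_of_le
    (fun P hP => hP.1 : V ≤ MvPolynomial.restrictTotalDegree (Fin 2) ℝ n)
  let F : V →ₗ[ℝ] Lp ℝ 2 (diskMeasure μ) :=
    { toFun := fun P => P.2.2.toLp _
      map_add' := fun P Q => by
        rw [← MemLp.toLp_add]
        exact MemLp.toLp_congr _ _ (by simp [hadd])
      map_smul' := fun c P => by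
        rw [RingHom.id_apply, ← MemLp.toLp_const_smul]
        exact MemLp.toLp_congr _ _ (by simp [hsmul]) }
  have hle : polyL2 μ n ≤ LinearMap.range F := by
    rintro g ⟨P, hP, hgP⟩
    have hm : MemLp (polyFun P) 2 (diskMeasure μ) := (memLp_congr_ae hgP).1 (Lp.memLp g)
    refine ⟨⟨P, hP, hm⟩, ?_⟩
    apply Lp.ext
    exact hm.coeFn_toLp.trans hgP.symm
  exact Submodule.finiteDimensional_of_le hle

/-- `V_k²(W_μ)`: the polynomials of degree (at most) `k` that are orthogonal in `L²(W_μ; B²)` to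
all polynomials of smaller degree. -/
def orthPoly (μ : ℝ) (k : ℕ) : Submodule ℝ (Lp ℝ 2 (diskMeasure μ)) :=
  polyL2 μ k ⊓ ⨅ n : Fin k, (polyL2 μ n)ᗮ

instance orthPoly_finiteDimensional (μ : ℝ) (k : ℕ) : FiniteDimensional ℝ (orthPoly μ k) :=
  Submodule.finiteDimensional_of_le (inf_le_left : orthPoly μ k ≤ polyL2 μ k)

theorem exists_poly_proj (μ : ℝ) (k : ℕ) (g : Lp ℝ 2 (diskMeasure μ)) :
    ∃ P : MvPolynomial (Fin 2) ℝ, P ∈ MvPolynomial.restrictTotalDegree (Fin 2) ℝ k ∧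
      (orthPoly μ k).starProjection g =ᵐ[diskMeasure μ] polyFun P :=
  (Submodule.mem_inf.1 (Submodule.starProjection_apply_mem (orthPoly μ k) g)).1

/-- `proj_k^μ f`, the orthogonal projection of `f ∈ L²(W_μ; B²)` onto `V_k²(W_μ)`, evaluated at the
point `(x, y)`; being an element of `V_k²(W_μ)`, it is a polynomial, and is evaluated as such. -/
def proj (μ : ℝ) (k : ℕ) (f : Lp ℝ 2 (diskMeasure μ)) (x y : ℝ) : ℝ :=
  polyFun (exists_poly_proj μ k f).choose (x, y)

/-- The point of the line `x cos θ + y sin θ = t` with arc length parameter `s`; it lies in `B²`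
exactly when `s² ≤ 1 - t²`. -/
def chord (θ t s : ℝ) : ℝ × ℝ :=
  (t * Real.cos θ - s * Real.sin θ, t * Real.sin θ + s * Real.cos θ)

/-- The integrand of the attenuated Radon projection. -/
def radonIntegrand (μ : ℝ) (f : ℝ × ℝ → ℝ) (θ t s : ℝ) : ℝ :=
  f (chord θ t s) * weight μ (chord θ t s)

/-- The attenuated Radon projection `R_θ^μ(f; t)`: the integral of `f W_μ` over the segment
`{x cos θ + y sin θ = t} ∩ B²` with respect to arc length. -/
def radon (μ : ℝ) (f : ℝ × ℝ → ℝ) (θ t : ℝ) : ℝ :=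
  ∫ s in (-√(1 - t ^ 2))..√(1 - t ^ 2), radonIntegrand μ f θ t s

/-- The Pochhammer symbol `(a)_n = a (a + 1) ⋯ (a + n - 1)`. -/
def poch (a : ℝ) (n : ℕ) : ℝ := (ascPochhammer ℝ n).eval a

/-- The Jacobi polynomial `P_n^{(α, β)}` in its standard normalization,
`P_n^{(α, β)}(1) = (α + 1)_n / n!`, for `α, β > -1`. -/
def jacobi (α β : ℝ) (n : ℕ) (t : ℝ) : ℝ :=
  poch (α + 1) n / n.factorial *
    ∑ j ∈ Finset.range (n + 1),
      (n.choose j : ℝ) * poch (n + α + β + 1) j / poch (α + 1) j * ((t - 1) / 2) ^ j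

/-- The weighted mean `c_{α, β} ∫_{-1}^1 g(t) (1 - t)^α (1 + t)^β dt`, where `c_{α, β}` makes the
mean of the constant `1` equal to `1`. -/
def jacobiMean (α β : ℝ) (g : ℝ → ℝ) : ℝ :=
  (∫ t in (-1 : ℝ)..1, (1 - t) ^ α * (1 + t) ^ β)⁻¹ *
    ∫ t in (-1 : ℝ)..1, g t * ((1 - t) ^ α * (1 + t) ^ β)

/-- The orthonormal Jacobi polynomial `p_n^{(α, β)}`. -/
def jacobiON (α β : ℝ) (n : ℕ) (t : ℝ) : ℝ :=
  jacobi α β n t / √(jacobiMean α β fun s => jacobi α β n s ^ 2)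

/-- The Gegenbauer polynomial
`C_n^λ = ((2λ)_n / (λ + 1/2)_n) P_n^{(λ - 1/2, λ - 1/2)}` for `λ > 0`. -/
def gegenbauer (lam : ℝ) (n : ℕ) (t : ℝ) : ℝ :=
  poch (2 * lam) n / poch (lam + 1 / 2) n * jacobi (lam - 1 / 2) (lam - 1 / 2) n t

/-- `h_{l,k}`, with `h_{l,k}² = Γ(k - 2l + μ + 3/2) / (Γ(μ + 3/2) Γ(k - 2l + 1))`, for `2l ≤ k`. -/
def hConst (μ : ℝ) (k l : ℕ) : ℝ :=
  √(Real.Gamma ((k - 2 * l : ℕ) + μ + 3 / 2) /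
    (Real.Gamma (μ + 3 / 2) * Real.Gamma ((k - 2 * l : ℕ) + 1)))

/-- `d_{l,k}`: the mean value `1/2` of `cos² ((k - 2l) φ)` if `2l < k`, and `1` if `2l = k`. -/
def dConst (k l : ℕ) : ℝ := if 2 * l < k then 1 / 2 else 1

/-- `r^j S_{j,ε}(φ)` in Cartesian coordinates, where `S_{j,0}(φ) = cos (j φ)` and
`S_{j,1}(φ) = sin (j φ)`: the real and imaginary part of `(x + i y)^j`. -/
def harmonic (ε : Fin 2) (j : ℕ) (x y : ℝ) : ℝ :=
  if ε = 0 then (((x : ℂ) + y * Complex.I) ^ j).re else (((x : ℂ) + y * Complex.I) ^ j).im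

theorem harmonic_polar (ε : Fin 2) (j : ℕ) (r φ : ℝ) :
    harmonic ε j (r * Real.cos φ) (r * Real.sin φ) =
      r ^ j * if ε = 0 then Real.cos (j * φ) else Real.sin (j * φ) := by
  have h : (((r * Real.cos φ : ℝ) : ℂ) + (r * Real.sin φ : ℝ) * Complex.I) ^ j =
      ((r ^ j * Real.cos (j * φ) : ℝ) : ℂ) + (r ^ j * Real.sin (j * φ) : ℝ) * Complex.I := by
    have h2 := Complex.cos_add_sin_mul_I_pow j (φ : ℂ)
    push_cast
    rw [show (r : ℂ) * Complex.cos φ + r * Complex.sin φ * Complex.I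
      = r * (Complex.cos φ + Complex.sin φ * Complex.I) by ring, mul_pow, h2]
    ring
  unfold harmonic
  rw [h]
  split_ifs <;> simp [-Complex.ofReal_mul, -Complex.ofReal_pow]

/-- The orthonormal basis `P_{l,ε}^k` of `V_k²(W_μ)`, where `0 ≤ 2l ≤ k` for `ε = 0` and
`0 ≤ 2l ≤ k - 1` for `ε = 1`. In polar coordinates it is
`d_{l,k}^{-1/2} h_{l,k} p_l^{(μ - 1/2, k - 2l)}(2r² - 1) r^{k - 2l} S_{k - 2l,ε}(φ)`; the factor
`d_{l,k}^{-1/2}` makes the norm equal to `1` also when `2l < k`. -/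
def basisPoly (μ : ℝ) (k l : ℕ) (ε : Fin 2) (x y : ℝ) : ℝ :=
  hConst μ k l / √(dConst k l) *
    jacobiON (μ - 1 / 2) (k - 2 * l : ℕ) l (2 * (x ^ 2 + y ^ 2) - 1) *
      harmonic ε (k - 2 * l) x y

/-- `H_{l,k}^μ = h_{l,k} p_l^{(μ - 1/2, k - 2l)}(1)`. -/
def HConst (μ : ℝ) (k l : ℕ) : ℝ := hConst μ k l * jacobiON (μ - 1 / 2) (k - 2 * l : ℕ) l 1

/-- `D_k^{μ+1/2}(ξ; x, y) = ∑ λ_{l,k}^μ P_{l,ε}^k(cos ξ, sin ξ) P_{l,ε}^k(x, y)` with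
`λ_{l,k}^μ = (H_{l,k}^μ)⁻²`, the sum over `ε = 0`, `0 ≤ 2l ≤ k` and `ε = 1`, `0 ≤ 2l < k`. -/
def ridgeKernel (μ : ℝ) (k : ℕ) (ξ x y : ℝ) : ℝ :=
  (∑ l ∈ (Finset.range (k + 1)).filter (fun l => 2 * l ≤ k), (HConst μ k l ^ 2)⁻¹ *
      (basisPoly μ k l 0 (Real.cos ξ) (Real.sin ξ) * basisPoly μ k l 0 x y)) +
    ∑ l ∈ (Finset.range (k + 1)).filter (fun l => 2 * l < k), (HConst μ k l ^ 2)⁻¹ *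
      (basisPoly μ k l 1 (Real.cos ξ) (Real.sin ξ) * basisPoly μ k l 1 x y)

/-- `D_k^{μ+1/2}(ξ, t; x, y)`. -/
def dKernel (μ : ℝ) (k : ℕ) (ξ t x y : ℝ) : ℝ :=
  (k + μ + 1 / 2) / (μ + 1 / 2) * gegenbauer (μ + 1 / 2) k t * ridgeKernel μ k ξ x y

/-- The angle `φ_ν = 2νπ / (2m + 1)`. -/
def angle (m ν : ℕ) : ℝ := 2 * ν * Real.pi / (2 * m + 1)

end AttenuatedRadon

end

/-!
For a profile `g`, Fubini's theorem along the chords orthogonal to `θ` gives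
`a_μ ∫ R_θ(f; t) g(t) dt = ⟨f, g(⟨·, θ⟩)⟩_μ` (`radon_ridge_fubini`), so that the right-hand side
of the formula is a combination of the inner products of `f` with the ridge polynomials
`C_k^{μ+1/2}(⟨·, φ_ν⟩)`. These lie in `V_k²(W_μ)`, hence `f` may be replaced by its projection `P`.

The Radon projection of a polynomial of degree at most `k` is `(1 - t²)^μ q(t)`, where `q` is a
polynomial of degree at most `k` and `q(1)` is a multiple of the value of the given polynomial at
`(cos θ, sin θ)` (`exists_radon_poly`). If the polynomial is in `V_k²(W_μ)`, then `q` is orthogonal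
to all polynomials of smaller degree for the weight `(1 - t²)^μ`, and so is a multiple of
`C_k^{μ+1/2}`. Together with the norm of the Gegenbauer polynomials this yields
`⟨P, C_k^{μ+1/2}(⟨·, θ⟩)⟩_μ = (μ + 1/2) / (k + μ + 1/2) · P(cos θ, sin θ)`
(`integral_mul_gegenbauer_ridge`). What remains to be shown is
`P(x, y) = (2m + 1)⁻¹ ∑_ν P(cos φ_ν, sin φ_ν) D_k(φ_ν; x, y)` for `P ∈ V_k²(W_μ)`
(`sum_circle_mul_ridgeKernel`).

In `D_k` the normalizing constants of the basis cancel: it is `∑ d⁻¹ S(ξ) B(x, y)`, where the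
multiple `B` of the basis polynomial `P_{l,ε}^k` equals `S_{k-2l,ε}` on the unit circle
(`ridge_term`). Since the degrees `k - 2l ≤ 2m` all have the same parity, the functions
`S_{k-2l,ε}` are orthogonal on the `2m + 1` angles (`sum_trig_mul_trig`), which gives the formula for
`P = B` and the linear independence of the `k + 1` polynomials `B`. They belong to `V_k²(W_μ)`, by
polar coordinates and the orthogonality of the Jacobi polynomials (`integral_discPoly_mul`), and span
it: an element of `V_k²(W_μ)` is determined by its `k + 1` coefficients of degree `k`, because an
element without such terms is orthogonal to itself (`leadingCoeffs_injective`).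
-/

noncomputable section

namespace AttenuatedRadon

/-! ### Alternating sums of Pochhammer symbols -/

open Polynomial in
/-- The `n`-th difference of a polynomial of degree less than `n` vanishes. -/
theorem sum_neg_one_pow_choose_mul_eval (n : ℕ) (p : ℝ[X]) (hp : p.natDegree < n) :
    ∑ j ∈ Finset.range (n + 1), (-1 : ℝ) ^ j * n.choose j * p.eval (j : ℝ) = 0 := by
  have h := congrFun (Polynomial.fwdDiff_iter_eq_zero_of_degree_lt hp) 0
  rw [fwdDiff_iter_eq_sum_shift, Pi.zero_apply] at h
  have h2 : (-1 : ℝ) ^ n * ∑ j ∈ Finset.range (n + 1), (-1 : ℝ) ^ j * n.choose j * p.eval (j : ℝ)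
      = 0 := by
    rw [← h, Finset.mul_sum]
    refine Finset.sum_congr rfl fun j hj => ?_
    have hj' : j ≤ n := Nat.lt_succ_iff.1 (Finset.mem_range.1 hj)
    have : (-1 : ℝ) ^ n * (-1) ^ j = (-1) ^ (n - j) := by
      rw [← pow_add, show n + j = (n - j) + 2 * j by omega, pow_add, pow_mul]; simp
    simp only [zsmul_eq_mul, zero_add, nsmul_eq_mul, mul_one]
    push_cast
    rw [← this]; ring
  exact (mul_eq_zero.1 h2).resolve_left (pow_ne_zero _ (by norm_num))

theorem poch_succ (a : ℝ) (n : ℕ) : poch a (n + 1) = poch a n * (a + n) := by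
  simp [poch, ascPochhammer_succ_eval]

@[simp] theorem poch_zero (a : ℝ) : poch a 0 = 1 := by simp [poch]

theorem poch_pos {a : ℝ} (ha : 0 < a) (n : ℕ) : 0 < poch a n := ascPochhammer_pos n a ha

theorem poch_add (a : ℝ) (m n : ℕ) : poch a (m + n) = poch a m * poch (a + m) n := by
  induction n with
  | zero => simp
  | succ n ih => rw [← add_assoc, poch_succ, ih, poch_succ]; push_cast; ring

theorem poch_succ_left (a : ℝ) (n : ℕ) : poch a (n + 1) = a * poch (a + 1) n := by
  rw [add_comm n 1, poch_add]
  simp [poch]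

theorem poch_neg (b : ℝ) (n : ℕ) : poch (-(b + n)) n = (-1) ^ n * poch (b + 1) n := by
  induction n generalizing b with
  | zero => simp
  | succ n ih =>
    rw [poch_succ, poch_succ_left (b + 1)]
    have := ih (b + 1)
    push_cast
    rw [show -(b + ((n : ℝ) + 1)) = -(b + 1 + n) by ring, this]
    ring

theorem Gamma_add_natCast {a : ℝ} (ha : 0 < a) (n : ℕ) :
    Real.Gamma (a + n) = poch a n * Real.Gamma a := by
  induction n with
  | zero => simp
  | succ n ih =>
    push_cast
    rw [← add_assoc, Real.Gamma_add_one (by positivity), ih, poch_succ]; ring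

theorem fwdDiff_iter_one_div (n : ℕ) {y : ℝ} (hy : 0 < y) :
    (fwdDiff (1 : ℝ))^[n] (fun x : ℝ => 1 / x) y = (-1) ^ n * n.factorial / poch y (n + 1) := by
  induction n generalizing y with
  | zero => simp [poch]
  | succ n ih =>
    rw [Function.iterate_succ_apply', fwdDiff, ih hy, ih (by positivity : 0 < y + 1)]
    have h1 := (poch_pos (by positivity : 0 < y + 1) n).ne'
    have h2 : y + 1 + n ≠ 0 := by positivity
    rw [poch_succ_left y (n + 1), poch_succ_left y n, poch_succ (y + 1)]
    rw [Nat.factorial_succ]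
    push_cast
    field_simp
    ring

/-- The `n`-th difference of `x ↦ 1 / x`. -/
theorem sum_neg_one_pow_choose_div (n : ℕ) {c : ℝ} (hc : 0 < c) :
    ∑ j ∈ Finset.range (n + 1), (-1 : ℝ) ^ j * n.choose j / (c + j) =
      n.factorial / poch c (n + 1) := by
  have h := fwdDiff_iter_one_div n hc
  rw [fwdDiff_iter_eq_sum_shift] at h
  have h3 : (-1 : ℝ) ^ n * (-1) ^ n = 1 := by rw [← mul_pow]; simp
  have h2 : (-1 : ℝ) ^ n * ∑ j ∈ Finset.range (n + 1), (-1 : ℝ) ^ j * n.choose j / (c + j)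
      = (-1) ^ n * n.factorial / poch c (n + 1) := by
    rw [← h, Finset.mul_sum]
    refine Finset.sum_congr rfl fun j hj => ?_
    have hj' : j ≤ n := Nat.lt_succ_iff.1 (Finset.mem_range.1 hj)
    have : (-1 : ℝ) ^ n * (-1) ^ j = (-1) ^ (n - j) := by
      rw [← pow_add, show n + j = (n - j) + 2 * j by omega, pow_add, pow_mul]; simp
    simp only [zsmul_eq_mul, nsmul_eq_mul, mul_one]
    push_cast
    rw [← this]; ring
  have h4 := congrArg (fun z => (-1 : ℝ) ^ n * z) h2
  simp only [← mul_assoc, h3, one_mul, mul_div_assoc] at h4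
  simpa [mul_div_assoc] using h4

open Polynomial in
/-- Writing `p(x) = (x + c) q(x) + p(-c)`, the term with `q` drops out, as `deg q < n`. -/
theorem sum_neg_one_pow_choose_mul_eval_div (n : ℕ) (p : ℝ[X]) (hp : p.natDegree ≤ n) {c : ℝ}
    (hc : 0 < c) :
    ∑ j ∈ Finset.range (n + 1), (-1 : ℝ) ^ j * n.choose j * p.eval (j : ℝ) / (c + j) =
      p.eval (-c) * (n.factorial / poch c (n + 1)) := by
  set q := p /ₘ (X - C (-c)) with hq
  have hpq : ∀ x, p.eval x = (x + c) * q.eval x + p.eval (-c) := by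
    intro x
    have h := congrArg (eval x) (modByMonic_add_div p (X - C (-c)))
    rw [modByMonic_X_sub_C_eq_C_eval] at h
    simp only [eval_add, eval_C, eval_mul, eval_sub, eval_X] at h
    rw [← h, hq]; ring
  have h0 : ∑ j ∈ Finset.range (n + 1), (-1 : ℝ) ^ j * n.choose j * q.eval (j : ℝ) = 0 := by
    rcases Nat.eq_zero_or_pos n with rfl | hn
    · have : q = 0 := by
        rw [hq, divByMonic_eq_zero_iff (monic_X_sub_C _), degree_X_sub_C]
        exact lt_of_le_of_lt degree_le_natDegree (by
          have : p.natDegree = 0 := by omega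
          rw [this]; exact_mod_cast Nat.zero_lt_one)
      simp [this]
    · apply sum_neg_one_pow_choose_mul_eval
      rw [hq, natDegree_divByMonic _ (monic_X_sub_C _), natDegree_X_sub_C]
      omega
  rw [← sum_neg_one_pow_choose_div n hc, Finset.mul_sum]
  rw [← sub_eq_zero, ← Finset.sum_sub_distrib, ← h0]
  refine Finset.sum_congr rfl fun j _ => ?_
  rw [hpq j]
  have : c + j ≠ 0 := by positivity
  field_simp
  ring

/-- The polynomial `x ↦ (x + a)_i`. -/
def pochPoly (a : ℝ) (i : ℕ) : Polynomial ℝ :=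
  (ascPochhammer ℝ i).comp (Polynomial.X + Polynomial.C a)

theorem pochPoly_eval (a x : ℝ) (i : ℕ) : (pochPoly a i).eval x = poch (x + a) i := by
  simp [pochPoly, poch, Polynomial.eval_comp]

theorem natDegree_pochPoly (a : ℝ) (i : ℕ) : (pochPoly a i).natDegree = i := by
  rw [pochPoly, Polynomial.natDegree_comp, ascPochhammer_natDegree, Polynomial.natDegree_X_add_C,
    mul_one]

/-- `(a + n)_j / (a + 1)_{i + j}` as a multiple of a polynomial in `j`. -/
theorem poch_ratio_of_lt {a : ℝ} (ha : 0 < a) {i n : ℕ} (hi : i < n) (j : ℕ) :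
    poch (a + n) j / poch (a + 1) (i + j) =
      a / poch a n * poch (j + (a + i + 1)) (n - 1 - i) := by
  have h1 := (poch_pos ha n).ne'
  have h2 := (poch_pos (by positivity : 0 < a + 1) (i + j)).ne'
  have h3 := poch_add a n j
  have h4 : poch a (n + j) = poch a (i + j + 1) * poch (a + (i + j + 1 : ℕ)) (n - 1 - i) := by
    rw [← poch_add]; congr 1; omega
  rw [poch_succ_left] at h4
  rw [div_eq_iff h2, div_mul_eq_mul_div, div_mul_eq_mul_div, eq_div_iff h1]
  push_cast at h4
  rw [show (j : ℝ) + (a + i + 1) = a + (i + j + 1) by ring]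
  linarith

/-- The borderline case `i = n` of `poch_ratio_of_lt`, in which a simple pole remains. -/
theorem poch_ratio_self {a : ℝ} (ha : 0 < a) (n : ℕ) (j : ℕ) :
    poch (a + n) j / poch (a + 1) (n + j) = a / poch a n / (a + n + j) := by
  have h1 := (poch_pos ha n).ne'
  have h2 := (poch_pos (by positivity : 0 < a + 1) (n + j)).ne'
  have h3 := poch_add a n j
  have h4 := poch_succ_left a (n + j)
  rw [poch_succ] at h4
  push_cast at h4
  have h5 : a + n + j ≠ 0 := by positivity
  rw [div_div, div_eq_div_iff h2 (by positivity)]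
  rw [h3] at h4
  linarith

/-- The sum for the `i`-th moment of a Jacobi polynomial of larger degree `n` vanishes, being the
`n`-th difference of a polynomial of degree `n - 1`. Here `α` stands for the usual `α + 1`, and `a`
for `α + β + 1`. -/
theorem jacobi_sum_eq_zero {α a : ℝ} (hα : 0 < α) (ha : 0 < a) {i n : ℕ} (hi : i < n) :
    ∑ j ∈ Finset.range (n + 1), (-1 : ℝ) ^ j * n.choose j * (poch (a + n) j / poch α j) *
      (poch α (i + j) / poch (a + 1) (i + j)) = 0 := by
  have h := sum_neg_one_pow_choose_mul_eval n
    (Polynomial.C (a / poch a n) * (pochPoly (a + i + 1) (n - 1 - i) * pochPoly α i)) (by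
      refine lt_of_le_of_lt (Polynomial.natDegree_C_mul_le _ _) ?_
      refine lt_of_le_of_lt Polynomial.natDegree_mul_le ?_
      rw [natDegree_pochPoly, natDegree_pochPoly]; omega)
  rw [← h]
  refine Finset.sum_congr rfl fun j _ => ?_
  rw [Polynomial.eval_mul, Polynomial.eval_mul, Polynomial.eval_C, pochPoly_eval, pochPoly_eval,
    ← mul_assoc (a / _), ← poch_ratio_of_lt ha hi, add_comm i j, poch_add α j i, add_comm (j : ℝ) α]
  have := (poch_pos hα j).ne'
  field_simp

/-- The sum for the `n`-th moment of the Jacobi polynomial of degree `n`, with parameters as in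
`jacobi_sum_eq_zero`. -/
theorem jacobi_sum_self {α a : ℝ} (hα : 0 < α) (ha : 0 < a) (n : ℕ) :
    ∑ j ∈ Finset.range (n + 1), (-1 : ℝ) ^ j * n.choose j * (poch (a + n) j / poch α j) *
      (poch α (n + j) / poch (a + 1) (n + j)) =
      a / poch a n * ((-1) ^ n * poch (a - α + 1) n) * (n.factorial / poch (a + n) (n + 1)) := by
  have h := sum_neg_one_pow_choose_mul_eval_div n
    (Polynomial.C (a / poch a n) * pochPoly α n) (by
      refine le_trans (Polynomial.natDegree_C_mul_le _ _) ?_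
      rw [natDegree_pochPoly]) (c := a + n) (by positivity)
  rw [Polynomial.eval_mul, Polynomial.eval_C, pochPoly_eval,
    show -(a + n) + α = -((a - α) + n) by ring, poch_neg] at h
  rw [← h]
  refine Finset.sum_congr rfl fun j _ => ?_
  rw [Polynomial.eval_mul, Polynomial.eval_C, pochPoly_eval, add_comm n j, poch_add α j n,
    mul_div_assoc (poch α j), add_comm (j : ℝ) α]
  have h3 := (poch_pos hα j).ne'
  have h4 := poch_ratio_self ha n j
  rw [add_comm n j] at h4
  have : poch (a + n) j / poch α j * (poch α j * (poch (α + j) n / poch (a + 1) (j + n))) =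
    poch (α + j) n * (poch (a + n) j / poch (a + 1) (j + n)) := by field_simp
  rw [mul_assoc, this, h4]
  ring

theorem real_beta_integral {a b : ℝ} (ha : 0 < a) (hb : 0 < b) :
    IntervalIntegrable (fun x : ℝ => x ^ (a - 1) * (1 - x) ^ (b - 1)) volume 0 1 ∧
    ∫ x in (0 : ℝ)..1, x ^ (a - 1) * (1 - x) ^ (b - 1) = ProbabilityTheory.beta a b := by
  have hc := Complex.betaIntegral_convergent (u := a) (v := b) (by simpa) (by simpa)
  have he : Set.EqOn (fun x : ℝ => (x : ℂ) ^ ((a : ℂ) - 1) * (1 - (x : ℂ)) ^ ((b : ℂ) - 1))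
      (fun x : ℝ => ((x ^ (a - 1) * (1 - x) ^ (b - 1) : ℝ) : ℂ)) (Set.uIoc 0 1) := by
    intro x hx
    rw [Set.uIoc_of_le zero_le_one] at hx
    simp only
    rw [Complex.ofReal_mul, Complex.ofReal_cpow hx.1.le, Complex.ofReal_cpow (by linarith [hx.2])]
    push_cast
    rfl
  have hi : IntervalIntegrable (fun x : ℝ => ((x ^ (a - 1) * (1 - x) ^ (b - 1) : ℝ) : ℂ))
      volume 0 1 := hc.congr he
  have hr : IntervalIntegrable (fun x : ℝ => x ^ (a - 1) * (1 - x) ^ (b - 1)) volume 0 1 := by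
    have h1 := hi.1.re
    have h2 := hi.2.re
    simp only [RCLike.re_eq_complex_re, Complex.ofReal_re] at h1 h2
    exact ⟨h1, h2⟩
  refine ⟨hr, ?_⟩
  rw [ProbabilityTheory.beta_eq_betaIntegralReal a b ha hb, Complex.betaIntegral,
    intervalIntegral.integral_congr_ae (g := fun x : ℝ => ((x ^ (a - 1) * (1 - x) ^ (b - 1) : ℝ) : ℂ))
      (Filter.Eventually.of_forall he), intervalIntegral.integral_ofReal, Complex.ofReal_re]

/-! ### Jacobi and Gegenbauer polynomials -/

/-- The Jacobi weight `(1 - t)^α (1 + t)^β`. -/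
def jacobiWeight (α β t : ℝ) : ℝ := (1 - t) ^ α * (1 + t) ^ β

/-- `∫_{-1}^1 g(t) (1 - t)^α (1 + t)^β dt`. -/
def jacobiInt (α β : ℝ) (g : ℝ → ℝ) : ℝ :=
  ∫ t in Set.Ioo (-1 : ℝ) 1, g t * jacobiWeight α β t

theorem jacobiWeight_pos {α β t : ℝ} (ht : t ∈ Set.Ioo (-1 : ℝ) 1) : 0 < jacobiWeight α β t :=
  mul_pos (Real.rpow_pos_of_pos (by linarith [ht.2]) _)
    (Real.rpow_pos_of_pos (by linarith [ht.1]) _)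

theorem jacobiMean_eq (α β : ℝ) (g : ℝ → ℝ) :
    jacobiMean α β g = (jacobiInt α β fun _ => 1)⁻¹ * jacobiInt α β g := by
  unfold jacobiMean jacobiInt jacobiWeight
  rw [intervalIntegral.integral_of_le (by norm_num), intervalIntegral.integral_of_le (by norm_num),
    integral_Ioc_eq_integral_Ioo, integral_Ioc_eq_integral_Ioo]
  simp

theorem integral_jacobiWeight {α β : ℝ} (hα : -1 < α) (hβ : -1 < β) :
    IntegrableOn (jacobiWeight α β) (Set.Ioo (-1) 1) ∧
    ∫ t in Set.Ioo (-1 : ℝ) 1, jacobiWeight α β t =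
      2 ^ (α + β + 1) * ProbabilityTheory.beta (α + 1) (β + 1) := by
  obtain ⟨h1, h2⟩ := real_beta_integral (a := α + 1) (b := β + 1) (by linarith) (by linarith)
  simp only [add_sub_cancel_right] at h1 h2
  have he : Set.EqOn (fun x : ℝ => jacobiWeight α β (1 - 2 * x))
      (fun x => 2 ^ (α + β) * (x ^ α * (1 - x) ^ β)) (Set.uIcc 0 1) := by
    intro x hx
    rw [Set.uIcc_of_le zero_le_one] at hx
    simp only [jacobiWeight]
    rw [show 1 - (1 - 2 * x) = 2 * x by ring, show 1 + (1 - 2 * x) = 2 * (1 - x) by ring,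
      Real.mul_rpow (by norm_num) hx.1, Real.mul_rpow (by norm_num) (by linarith [hx.2]),
      Real.rpow_add (by norm_num)]
    ring
  have hi : IntervalIntegrable (fun x : ℝ => jacobiWeight α β (1 - 2 * x)) volume 0 1 :=
    (h1.const_mul _).congr (fun x hx => (he (Set.uIoc_subset_uIcc hx)).symm)
  have hi2 : IntervalIntegrable (jacobiWeight α β) volume (-1) 1 := by
    have h3 := (hi.comp_sub_left 1).comp_mul_left (c := 1 / 2)
    have h4 := hi.comp_mul_left (c := 1 / 2) |>.comp_sub_left 1
    norm_num at h4
    refine (h4.symm.congr ?_)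
    intro x _
    simp only
    congr 1
    ring
  rw [intervalIntegrable_iff_integrableOn_Ioo_of_le (by norm_num)] at hi2
  refine ⟨hi2, ?_⟩
  rw [← integral_Ioc_eq_integral_Ioo, ← intervalIntegral.integral_of_le (by norm_num)]
  have h5 := intervalIntegral.integral_comp_sub_mul (a := 0) (b := 1) (jacobiWeight α β)
    (c := 2) (by norm_num) 1
  rw [intervalIntegral.integral_congr he, intervalIntegral.integral_const_mul, h2] at h5
  norm_num at h5
  rw [Real.rpow_add (by norm_num), Real.rpow_one]
  linarith

theorem integrableOn_mul_jacobiWeight {α β : ℝ} (hα : -1 < α) (hβ : -1 < β) {g : ℝ → ℝ}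
    (hg : Continuous g) :
    IntegrableOn (fun t => g t * jacobiWeight α β t) (Set.Ioo (-1) 1) :=
  IntegrableOn.continuousOn_mul_of_subset hg.continuousOn (integral_jacobiWeight hα hβ).1
    isCompact_Icc measurableSet_Ioo Set.Ioo_subset_Icc_self

theorem jacobiInt_one_pos {α β : ℝ} (hα : -1 < α) (hβ : -1 < β) :
    0 < jacobiInt α β fun _ => 1 := by
  simp only [jacobiInt, one_mul]
  rw [(integral_jacobiWeight hα hβ).2]
  exact mul_pos (Real.rpow_pos_of_pos (by norm_num) _)
    (ProbabilityTheory.beta_pos (by linarith) (by linarith))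

theorem jacobiInt_pow {α β : ℝ} (hα : -1 < α) (hβ : -1 < β) (i : ℕ) :
    jacobiInt α β (fun t => ((1 - t) / 2) ^ i) =
      (jacobiInt α β fun _ => 1) * (poch (α + 1) i / poch (α + β + 2) i) := by
  have h1 : jacobiInt α β (fun t => ((1 - t) / 2) ^ i) =
      ∫ t in Set.Ioo (-1 : ℝ) 1, (1 / 2) ^ i * jacobiWeight (α + i) β t := by
    refine setIntegral_congr_fun measurableSet_Ioo fun t ht => ?_
    simp only [jacobiWeight]
    rw [Real.rpow_add_natCast (by linarith [ht.2] : 1 - t ≠ 0), div_pow, div_pow, one_pow]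
    ring
  rw [h1, integral_const_mul, (integral_jacobiWeight (by linarith [Nat.cast_nonneg (α := ℝ) i]) hβ).2]
  simp only [jacobiInt, one_mul]
  rw [(integral_jacobiWeight hα hβ).2]
  unfold ProbabilityTheory.beta
  rw [show α + i + 1 = (α + 1) + i by ring, Gamma_add_natCast (by linarith),
    show α + 1 + i + (β + 1) = (α + β + 2) + i by ring, Gamma_add_natCast (by linarith),
    show α + i + β + 1 = (α + β + 1) + i by ring, Real.rpow_add_natCast (by norm_num),
    show α + 1 + (β + 1) = α + β + 2 by ring]
  have := (poch_pos (by linarith : 0 < α + β + 2) i).ne'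
  have := (Real.Gamma_pos_of_pos (by linarith : 0 < α + β + 2)).ne'
  rw [one_div, inv_pow]
  field_simp

theorem jacobiInt_sum {ι : Type*} (s : Finset ι) {α β : ℝ} (hα : -1 < α) (hβ : -1 < β)
    (c : ι → ℝ) (g : ι → ℝ → ℝ) (hg : ∀ i ∈ s, Continuous (g i)) :
    jacobiInt α β (fun t => ∑ i ∈ s, c i * g i t) = ∑ i ∈ s, c i * jacobiInt α β (g i) := by
  unfold jacobiInt
  simp_rw [Finset.sum_mul, mul_assoc]
  rw [integral_finsetSum _ fun i hi => (integrableOn_mul_jacobiWeight hα hβ (hg i hi)).const_mul _]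
  simp_rw [integral_const_mul]

/-- The polynomial `q` with `P_n^{(α, β)}(t) = q((1 - t) / 2)`. -/
def jacobiPoly (α β : ℝ) (n : ℕ) : Polynomial ℝ :=
  ∑ j ∈ Finset.range (n + 1), Polynomial.monomial j
    (poch (α + 1) n / n.factorial *
      ((-1) ^ j * n.choose j * (poch (n + α + β + 1) j / poch (α + 1) j)))

theorem jacobiPoly_eval (α β : ℝ) (n : ℕ) (t : ℝ) :
    (jacobiPoly α β n).eval ((1 - t) / 2) = jacobi α β n t := by
  rw [jacobiPoly, Polynomial.eval_finsetSum, jacobi, Finset.mul_sum]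
  refine Finset.sum_congr rfl fun j _ => ?_
  rw [Polynomial.eval_monomial, show (t - 1) / 2 = -1 * ((1 - t) / 2) by ring, mul_pow]
  ring

theorem natDegree_jacobiPoly_le (α β : ℝ) (n : ℕ) : (jacobiPoly α β n).natDegree ≤ n := by
  refine Polynomial.natDegree_sum_le_of_forall_le _ _ fun j hj => ?_
  exact (Polynomial.natDegree_monomial_le _).trans (Nat.lt_succ_iff.1 (Finset.mem_range.1 hj))

theorem jacobiPoly_coeff_self (α β : ℝ) (hα : -1 < α) (n : ℕ) :
    (jacobiPoly α β n).coeff n = (-1) ^ n * poch (n + α + β + 1) n / n.factorial := by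
  rw [jacobiPoly, Polynomial.finsetSum_coeff, Finset.sum_range_succ, Finset.sum_eq_zero]
  · have := (poch_pos (by linarith : 0 < α + 1) n).ne'
    simp
    field_simp
  · intro j hj
    rw [Polynomial.coeff_monomial, if_neg (Finset.mem_range.1 hj).ne]

theorem continuous_jacobi (α β : ℝ) (n : ℕ) : Continuous (jacobi α β n) := by
  unfold jacobi; fun_prop

theorem jacobi_one (α β : ℝ) (n : ℕ) : jacobi α β n 1 = poch (α + 1) n / n.factorial := by
  rw [jacobi, Finset.sum_range_succ', Finset.sum_eq_zero]
  · simp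
  · intro j _; simp

/-- The moments of a Jacobi polynomial, as finite sums. -/
theorem jacobiInt_jacobi_mul_pow {α β : ℝ} (hα : -1 < α) (hβ : -1 < β) (n i : ℕ) :
    jacobiInt α β (fun t => jacobi α β n t * ((1 - t) / 2) ^ i) =
      (jacobiInt α β fun _ => 1) * (poch (α + 1) n / n.factorial *
      ∑ j ∈ Finset.range (n + 1), (-1 : ℝ) ^ j * n.choose j *
        (poch (n + α + β + 1) j / poch (α + 1) j) *
        (poch (α + 1) (i + j) / poch (α + β + 2) (i + j))) := by
  have h1 : (fun t => jacobi α β n t * ((1 - t) / 2) ^ i) = fun t =>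
      ∑ j ∈ Finset.range (n + 1), (poch (α + 1) n / n.factorial * ((-1 : ℝ) ^ j * n.choose j *
        (poch (n + α + β + 1) j / poch (α + 1) j))) * ((1 - t) / 2) ^ (i + j) := by
    funext t
    rw [jacobi, Finset.mul_sum, Finset.sum_mul]
    refine Finset.sum_congr rfl fun j _ => ?_
    rw [show (t - 1) / 2 = -1 * ((1 - t) / 2) by ring, mul_pow, pow_add]
    ring
  rw [h1, jacobiInt_sum _ hα hβ _ (fun j t => ((1 - t) / 2) ^ (i + j)) (fun j _ => by fun_prop),
    Finset.mul_sum, Finset.mul_sum]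
  refine Finset.sum_congr rfl fun j _ => ?_
  rw [jacobiInt_pow hα hβ]
  ring

theorem jacobiInt_jacobi_mul_pow_of_lt {α β : ℝ} (hα : -1 < α) (hβ : -1 < β)
    (hαβ : 0 < α + β + 1) {n i : ℕ} (hi : i < n) :
    jacobiInt α β (fun t => jacobi α β n t * ((1 - t) / 2) ^ i) = 0 := by
  have h := jacobi_sum_eq_zero (by linarith : 0 < α + 1) hαβ hi
  rw [jacobiInt_jacobi_mul_pow hα hβ]
  rw [show α + β + 1 + n = n + α + β + 1 by ring, show α + β + 1 + 1 = α + β + 2 by ring] at h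
  rw [h]; ring

/-- The value of `∫ P_n^{(α, β)}(t)² (1 - t)^α (1 + t)^β dt`, up to the total mass, divided by the
leading coefficient of `P_n^{(α, β)}` as a polynomial in `(1 - t) / 2`. -/
theorem jacobiInt_jacobi_mul_pow_self {α β : ℝ} (hα : -1 < α) (hβ : -1 < β)
    (hαβ : 0 < α + β + 1) (n : ℕ) :
    jacobiInt α β (fun t => jacobi α β n t * ((1 - t) / 2) ^ n) =
      (jacobiInt α β fun _ => 1) * (poch (α + 1) n *
      ((α + β + 1) / poch (α + β + 1) n * ((-1) ^ n * poch (β + 1) n) /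
        poch (n + α + β + 1) (n + 1))) := by
  have h := jacobi_sum_self (by linarith : 0 < α + 1) hαβ n
  rw [jacobiInt_jacobi_mul_pow hα hβ]
  rw [show α + β + 1 + n = n + α + β + 1 by ring, show α + β + 1 + 1 = α + β + 2 by ring,
    show α + β + 1 - (α + 1) + 1 = β + 1 by ring] at h
  rw [h]
  have : (n.factorial : ℝ) ≠ 0 := by positivity
  field_simp

open Polynomial in
/-- Only the leading coefficient of a polynomial of degree at most `n` contributes to its integral
against `P_n^{(α, β)}`. -/
theorem jacobiInt_jacobi_mul_eval {α β : ℝ} (hα : -1 < α) (hβ : -1 < β)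
    (hαβ : 0 < α + β + 1) {n : ℕ} (q : ℝ[X]) (hq : q.natDegree ≤ n) :
    jacobiInt α β (fun t => jacobi α β n t * q.eval ((1 - t) / 2)) =
      q.coeff n * jacobiInt α β (fun t => jacobi α β n t * ((1 - t) / 2) ^ n) := by
  have h1 : (fun t => jacobi α β n t * q.eval ((1 - t) / 2)) = fun t =>
      ∑ i ∈ Finset.range (n + 1), q.coeff i * (jacobi α β n t * ((1 - t) / 2) ^ i) := by
    funext t
    rw [eval_eq_sum_range' (Nat.lt_succ_of_le hq), Finset.mul_sum]
    exact Finset.sum_congr rfl fun i _ => by ring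
  rw [h1, jacobiInt_sum _ hα hβ _ (fun i t => jacobi α β n t * ((1 - t) / 2) ^ i)
    (fun i _ => (continuous_jacobi _ _ _).mul (by fun_prop)), Finset.sum_range_succ,
    Finset.sum_eq_zero, zero_add]
  intro i hi
  rw [jacobiInt_jacobi_mul_pow_of_lt hα hβ hαβ (Finset.mem_range.1 hi), mul_zero]

open Polynomial in
/-- `P_n^{(α, β)}` is orthogonal to the polynomials of degree less than `n`. -/
theorem jacobiInt_jacobi_mul_eval_eq_zero {α β : ℝ} (hα : -1 < α) (hβ : -1 < β)
    (hαβ : 0 < α + β + 1) {n : ℕ} (p : ℝ[X]) (hp : p.natDegree < n) :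
    jacobiInt α β (fun t => jacobi α β n t * p.eval t) = 0 := by
  have hd : (p.comp (C 1 - C 2 * X)).natDegree < n := by
    refine lt_of_le_of_lt natDegree_comp_le (lt_of_le_of_lt ?_ hp)
    refine (Nat.mul_le_mul_left _ (?_ : _ ≤ 1)).trans_eq (mul_one _)
    compute_degree
  have h := jacobiInt_jacobi_mul_eval hα hβ hαβ (p.comp (C 1 - C 2 * X)) hd.le
  rw [coeff_eq_zero_of_natDegree_lt hd, zero_mul] at h
  rw [← h]
  congr 1
  funext t
  rw [eval_comp]
  congr 2
  simp
  ring

theorem jacobiInt_jacobi_sq {α β : ℝ} (hα : -1 < α) (hβ : -1 < β)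
    (hαβ : 0 < α + β + 1) (n : ℕ) :
    jacobiInt α β (fun t => jacobi α β n t ^ 2) =
      (jacobiInt α β fun _ => 1) * (poch (α + 1) n * poch (β + 1) n * (α + β + 1) /
        (n.factorial * poch (α + β + 1) n * (α + β + 1 + 2 * n))) := by
  have h := jacobiInt_jacobi_mul_eval hα hβ hαβ _ (natDegree_jacobiPoly_le α β n)
  simp only [jacobiPoly_eval, ← sq] at h
  rw [h, jacobiPoly_coeff_self _ _ hα, jacobiInt_jacobi_mul_pow_self hα hβ hαβ, poch_succ]
  have h1 := (poch_pos (by linarith [Nat.cast_nonneg (α := ℝ) n] : 0 < (n : ℝ) + α + β + 1) n).ne'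
  have h2 := (poch_pos hαβ n).ne'
  have h3 : α + β + 1 + 2 * n ≠ 0 := by positivity
  have h4 : (n : ℝ) + α + β + 1 + n ≠ 0 := by
    rw [show (n : ℝ) + α + β + 1 + n = α + β + 1 + 2 * n by ring]; exact h3
  have h5 : (-1 : ℝ) ^ n * (-1) ^ n = 1 := by rw [← mul_pow]; simp
  field_simp
  linear_combination ((jacobiInt α β fun _ => 1) * poch (α + 1) n * poch (β + 1) n *
    (α + β + 1 + 2 * n)) * h5

theorem jacobiMean_jacobi_sq_pos {α β : ℝ} (hα : -1 < α) (hβ : -1 < β)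
    (hαβ : 0 < α + β + 1) (n : ℕ) : 0 < jacobiMean α β fun s => jacobi α β n s ^ 2 := by
  rw [jacobiMean_eq, jacobiInt_jacobi_sq hα hβ hαβ]
  have h0 := jacobiInt_one_pos hα hβ
  have h1 := poch_pos (by linarith : 0 < α + 1) n
  have h2 := poch_pos (by linarith : 0 < β + 1) n
  have h3 := poch_pos hαβ n
  positivity

theorem gegenbauer_one (lam : ℝ) (hlam : 0 < lam) (n : ℕ) :
    gegenbauer lam n 1 = poch (2 * lam) n / n.factorial := by
  rw [gegenbauer, jacobi_one, show lam - 1 / 2 + 1 = lam + 1 / 2 by ring]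
  exact div_mul_div_cancel₀ (poch_pos (by linarith : 0 < lam + 1 / 2) n).ne'

theorem gegenbauer_one_pos (lam : ℝ) (hlam : 0 < lam) (n : ℕ) : 0 < gegenbauer lam n 1 := by
  rw [gegenbauer_one lam hlam]
  exact div_pos (poch_pos (by linarith) n) (by positivity)

theorem continuous_gegenbauer (lam : ℝ) (n : ℕ) : Continuous (gegenbauer lam n) := by
  unfold gegenbauer
  exact continuous_const.mul (continuous_jacobi _ _ _)

theorem jacobiInt_const_mul (α β c : ℝ) (g : ℝ → ℝ) :
    jacobiInt α β (fun t => c * g t) = c * jacobiInt α β g := by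
  unfold jacobiInt
  simp_rw [mul_assoc]
  rw [integral_const_mul]

open Polynomial in
theorem jacobiInt_gegenbauer_mul_eval_eq_zero {lam : ℝ} (hlam : 0 < lam) {n : ℕ} (p : ℝ[X])
    (hp : p.natDegree < n) :
    jacobiInt (lam - 1 / 2) (lam - 1 / 2) (fun t => gegenbauer lam n t * p.eval t) = 0 := by
  simp only [gegenbauer, mul_assoc]
  rw [jacobiInt_const_mul, jacobiInt_jacobi_mul_eval_eq_zero (by linarith) (by linarith)
    (by linarith) p hp, mul_zero]

/-- The norm of the Gegenbauer polynomials; it produces the factor `(k + μ + 1/2) / (μ + 1/2)` of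
the kernel. -/
theorem jacobiInt_gegenbauer_sq {lam : ℝ} (hlam : 0 < lam) (n : ℕ) :
    jacobiInt (lam - 1 / 2) (lam - 1 / 2) (fun t => gegenbauer lam n t ^ 2) =
      (jacobiInt (lam - 1 / 2) (lam - 1 / 2) fun _ => 1) *
        (lam / (n + lam) * gegenbauer lam n 1) := by
  rw [gegenbauer_one lam hlam]
  simp only [gegenbauer, mul_pow]
  rw [jacobiInt_const_mul, jacobiInt_jacobi_sq (by linarith) (by linarith) (by linarith)]
  rw [show lam - 1 / 2 + 1 = lam + 1 / 2 by ring,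
    show lam - 1 / 2 + (lam - 1 / 2) + 1 = 2 * lam by ring]
  have hp := (poch_pos (by linarith : 0 < lam + 1 / 2) n).ne'
  generalize poch (lam + 1 / 2) n = P at hp
  generalize jacobiInt (lam - 1 / 2) (lam - 1 / 2) (fun _ => 1) = J
  have := (poch_pos (by linarith : 0 < 2 * lam) n).ne'
  have : 2 * lam + 2 * n ≠ 0 := by positivity
  have : n + lam ≠ 0 := by positivity
  field_simp
  ring

open Polynomial in
theorem exists_gegenbauer_poly (lam : ℝ) (n : ℕ) :
    ∃ p : ℝ[X], p.natDegree ≤ n ∧ ∀ t, p.eval t = gegenbauer lam n t := by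
  refine ⟨C (poch (2 * lam) n / poch (lam + 1 / 2) n) *
    (jacobiPoly (lam - 1 / 2) (lam - 1 / 2) n).comp (C (1 / 2) - C (1 / 2) * X), ?_, fun t => ?_⟩
  · refine (natDegree_C_mul_le _ _).trans (natDegree_comp_le.trans ?_)
    refine (Nat.mul_le_mul (natDegree_jacobiPoly_le _ _ n) (?_ : _ ≤ 1)).trans_eq (mul_one _)
    compute_degree
  · rw [eval_mul, eval_C, eval_comp, gegenbauer, ← jacobiPoly_eval]
    congr 2
    simp
    ring

open Polynomial in
theorem exists_jacobi_poly (α β : ℝ) (n : ℕ) :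
    ∃ p : ℝ[X], p.natDegree ≤ n ∧ ∀ t, p.eval t = jacobi α β n t := by
  refine ⟨(jacobiPoly α β n).comp (C (1 / 2) - C (1 / 2) * X), ?_, fun t => ?_⟩
  · refine natDegree_comp_le.trans ?_
    refine (Nat.mul_le_mul (natDegree_jacobiPoly_le _ _ n) (?_ : _ ≤ 1)).trans_eq (mul_one _)
    compute_degree
  · rw [eval_comp, ← jacobiPoly_eval]
    congr 1
    simp
    ring

open Polynomial in
theorem eq_zero_of_jacobiInt_sq {α β : ℝ} (hα : -1 < α) (hβ : -1 < β) (p : ℝ[X])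
    (h : jacobiInt α β (fun t => p.eval t ^ 2) = 0) : p = 0 := by
  unfold jacobiInt at h
  have hc : Continuous fun t => p.eval t ^ 2 := by fun_prop
  rw [setIntegral_eq_zero_iff_of_nonneg_ae ?_ (integrableOn_mul_jacobiWeight hα hβ hc)] at h
  · have h2 : ∀ᵐ t ∂(volume.restrict (Set.Ioo (-1 : ℝ) 1)), t ∈ {x | p.IsRoot x} := by
      filter_upwards [h, ae_restrict_mem measurableSet_Ioo] with t ht hm
      have := (jacobiWeight_pos (α := α) (β := β) hm).ne'
      simpa [this] using ht
    by_contra hp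
    have hfin : {x | p.IsRoot x}.Finite := finite_setOfPred_isRoot hp
    have h3 : volume.restrict (Set.Ioo (-1 : ℝ) 1) {x | p.IsRoot x} = 0 :=
      hfin.measure_zero _
    have h4 := measure_univ_le_add_compl (μ := volume.restrict (Set.Ioo (-1 : ℝ) 1)) {x | p.IsRoot x}
    have h5 := mem_ae_iff.1 h2
    rw [h3, zero_add] at h4
    have h4 := h4.trans_eq h5
    simp at h4
    norm_num at h4
  · filter_upwards [ae_restrict_mem measurableSet_Ioo] with t hm
    exact mul_nonneg (sq_nonneg _) (jacobiWeight_pos hm).le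

open Polynomial in
/-- A polynomial of degree at most `n` that is orthogonal to all polynomials of smaller degree is a
multiple of the Gegenbauer polynomial; the factor is read off at `t = 1`. -/
theorem jacobiInt_mul_gegenbauer_of_orthogonal {lam : ℝ} (hlam : 0 < lam) {n : ℕ} (q : ℝ[X])
    (hq : q.natDegree ≤ n)
    (hort : ∀ p : ℝ[X], p.natDegree < n →
      jacobiInt (lam - 1 / 2) (lam - 1 / 2) (fun t => q.eval t * p.eval t) = 0) :
    jacobiInt (lam - 1 / 2) (lam - 1 / 2) (fun t => q.eval t * gegenbauer lam n t) =
      (jacobiInt (lam - 1 / 2) (lam - 1 / 2) fun _ => 1) * (lam / (n + lam)) * q.eval 1 := by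
  obtain ⟨g, hgd, hg⟩ := exists_gegenbauer_poly lam n
  have hα : -1 < lam - 1 / 2 := by linarith
  -- `r` vanishes at `1`, and is orthogonal to its own cofactor `r / (t - 1)`
  set r := C (q.eval 1) * g - C (g.eval 1) * q with hr
  have hr1 : r.eval 1 = 0 := by simp [hr, mul_comm]
  have hrd : r.natDegree ≤ n := by
    refine (natDegree_sub_le _ _).trans (max_le ?_ ?_)
    · exact (natDegree_C_mul_le _ _).trans hgd
    · exact (natDegree_C_mul_le _ _).trans hq
  set s := r /ₘ (X - C 1) with hs
  have hrs : r = (X - C 1) * s := (mul_divByMonic_eq_iff_isRoot.2 hr1).symm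
  have hr0 : r = 0 := by
    rcases Nat.eq_zero_or_pos n with rfl | hn
    · rw [eq_C_of_natDegree_le_zero hrd] at hr1 ⊢
      simpa using hr1
    · have hsd : s.natDegree < n := by
        rw [hs, natDegree_divByMonic _ (monic_X_sub_C _), natDegree_X_sub_C]; omega
      have h1 := hort s hsd
      have h2 := jacobiInt_gegenbauer_mul_eval_eq_zero hlam s hsd
      have h3 : jacobiInt (lam - 1 / 2) (lam - 1 / 2) (fun t => r.eval t * s.eval t) = 0 := by
        have h4 : (fun t => r.eval t * s.eval t) = fun t => ∑ b : Bool,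
            (if b then q.eval 1 else -g.eval 1) *
            (if b then gegenbauer lam n t * s.eval t else q.eval t * s.eval t) := by
          funext t
          simp [hr, hg]; ring
        rw [h4, jacobiInt_sum _ hα hα _
          (fun (b : Bool) t => if b then gegenbauer lam n t * s.eval t else q.eval t * s.eval t)]
        · rw [Fintype.sum_bool]
          simp only [Bool.false_eq_true, if_false, if_true, h1, h2, mul_zero, add_zero]
        · rintro (_ | _) _
          · simp only [Bool.false_eq_true, if_false]; fun_prop
          · simp only [if_true]; exact (continuous_gegenbauer _ _).mul (by fun_prop)
      have h5 : jacobiInt (lam - 1 / 2 + 1) (lam - 1 / 2) (fun t => s.eval t ^ 2) = 0 := by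
        rw [← neg_eq_zero, ← h3, jacobiInt, jacobiInt, ← integral_neg]
        refine setIntegral_congr_fun measurableSet_Ioo fun t ht => ?_
        simp only [jacobiWeight]
        rw [Real.rpow_add_one (by linarith [ht.2] : 1 - t ≠ 0), hrs]
        simp only [eval_mul, eval_sub, eval_X, eval_C]
        ring
      rw [hrs, eq_zero_of_jacobiInt_sq (by linarith) hα s h5, mul_zero]
  have hpos := gegenbauer_one_pos lam hlam n
  have hval : ∀ t, q.eval t = q.eval 1 / gegenbauer lam n 1 * gegenbauer lam n t := by
    intro t
    have h6 := congrArg (eval t) hr0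
    simp only [hr, eval_sub, eval_mul, eval_C, hg, eval_zero] at h6
    field_simp
    linarith
  have h7 : (fun t => q.eval t * gegenbauer lam n t) =
      fun t => q.eval 1 / gegenbauer lam n 1 * gegenbauer lam n t ^ 2 := by
    funext t; rw [hval t]; ring
  rw [h7, jacobiInt_const_mul, jacobiInt_gegenbauer_sq hlam]
  field_simp

/-! ### Polynomial functions on the plane -/

/-- `F` is a polynomial function on the plane of total degree at most `n`. -/
def IsPoly (n : ℕ) (F : ℝ × ℝ → ℝ) : Prop :=
  ∃ P : MvPolynomial (Fin 2) ℝ, P.totalDegree ≤ n ∧ ∀ p, F p = polyFun P p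

namespace IsPoly

theorem mono {m n : ℕ} {F : ℝ × ℝ → ℝ} (h : IsPoly m F) (hmn : m ≤ n) : IsPoly n F := by
  obtain ⟨P, hP, hF⟩ := h
  exact ⟨P, hP.trans hmn, hF⟩

theorem const (n : ℕ) (c : ℝ) : IsPoly n fun _ => c :=
  ⟨MvPolynomial.C c, by simp, fun p => by simp [polyFun]⟩

theorem fst : IsPoly 1 Prod.fst :=
  ⟨MvPolynomial.X 0, by simp, fun p => by simp [polyFun]⟩

theorem snd : IsPoly 1 Prod.snd :=
  ⟨MvPolynomial.X 1, by simp, fun p => by simp [polyFun]⟩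

theorem add {n : ℕ} {F G : ℝ × ℝ → ℝ} (hF : IsPoly n F) (hG : IsPoly n G) :
    IsPoly n fun p => F p + G p := by
  obtain ⟨P, hP, hF⟩ := hF
  obtain ⟨Q, hQ, hG⟩ := hG
  exact ⟨P + Q, (MvPolynomial.totalDegree_add _ _).trans (max_le hP hQ), fun p => by
    simp [hF, hG, polyFun]⟩

theorem mul {m n : ℕ} {F G : ℝ × ℝ → ℝ} (hF : IsPoly m F) (hG : IsPoly n G) :
    IsPoly (m + n) fun p => F p * G p := by
  obtain ⟨P, hP, hF⟩ := hF
  obtain ⟨Q, hQ, hG⟩ := hG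
  exact ⟨P * Q, (MvPolynomial.totalDegree_mul _ _).trans (add_le_add hP hQ), fun p => by
    simp [hF, hG, polyFun]⟩

theorem const_mul {n : ℕ} {F : ℝ × ℝ → ℝ} (c : ℝ) (hF : IsPoly n F) :
    IsPoly n fun p => c * F p := by
  simpa using (const 0 c).mul hF

theorem sub {n : ℕ} {F G : ℝ × ℝ → ℝ} (hF : IsPoly n F) (hG : IsPoly n G) :
    IsPoly n fun p => F p - G p := by
  simpa [sub_eq_add_neg] using hF.add (hG.const_mul (-1))

theorem pow {n : ℕ} {F : ℝ × ℝ → ℝ} (hF : IsPoly n F) (a : ℕ) :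
    IsPoly (a * n) fun p => F p ^ a := by
  induction a with
  | zero => simpa using const 0 1
  | succ a ih => simpa [pow_succ, Nat.succ_mul] using ih.mul hF

theorem sum {n : ℕ} {ι : Type*} (s : Finset ι) {F : ι → ℝ × ℝ → ℝ}
    (hF : ∀ i ∈ s, IsPoly n (F i)) : IsPoly n fun p => ∑ i ∈ s, F i p := by
  classical
  induction s using Finset.induction_on with
  | empty => simpa using const n 0
  | insert a s ha ih =>
    simp_rw [Finset.sum_insert ha]
    exact (hF a (Finset.mem_insert_self _ _)).add (ih fun i hi => hF i (Finset.mem_insert_of_mem hi))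

theorem eval {m n : ℕ} {F : ℝ × ℝ → ℝ} (p : Polynomial ℝ) (hp : p.natDegree ≤ m)
    (hF : IsPoly n F) : IsPoly (m * n) fun z => p.eval (F z) := by
  simp_rw [Polynomial.eval_eq_sum_range' (Nat.lt_succ_of_le hp)]
  refine sum _ fun i hi => ((hF.pow i).const_mul _).mono ?_
  exact Nat.mul_le_mul_right _ (Nat.lt_succ_iff.1 (Finset.mem_range.1 hi))

theorem monomial_expansion (P : MvPolynomial (Fin 2) ℝ) (p : ℝ × ℝ) :
    polyFun P p = ∑ d ∈ P.support, P.coeff d * (p.1 ^ d 0 * p.2 ^ d 1) := by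
  simp [polyFun, MvPolynomial.eval_eq', Fin.prod_univ_two]

theorem degree_le_of_mem_support {P : MvPolynomial (Fin 2) ℝ} {d : Fin 2 →₀ ℕ}
    (hd : d ∈ P.support) : d 0 + d 1 ≤ P.totalDegree := by
  have := MvPolynomial.le_totalDegree hd
  rwa [Finsupp.sum_fintype _ _ (fun _ => rfl), Fin.sum_univ_two] at this

theorem continuous {n : ℕ} {F : ℝ × ℝ → ℝ} (hF : IsPoly n F) : Continuous F := by
  obtain ⟨P, -, hF⟩ := hF
  have : F = fun p => ∑ d ∈ P.support, P.coeff d * (p.1 ^ d 0 * p.2 ^ d 1) := by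
    funext p; rw [hF, monomial_expansion]
  rw [this]
  fun_prop

/-- A property of functions that is closed under linear combinations holds for all polynomials of
degree at most `n` if it holds for the monomials. -/
theorem induction_monomial {n : ℕ} {p : (ℝ × ℝ → ℝ) → Prop} (zero : p fun _ => 0)
    (add : ∀ c F G, p F → p G → p fun z => F z + c * G z)
    (mon : ∀ a b, a + b ≤ n → p fun z => z.1 ^ a * z.2 ^ b) {F : ℝ × ℝ → ℝ} (hF : IsPoly n F) :
    p F := by
  obtain ⟨P, hP, hF⟩ := hF
  have hF' : F = fun z => ∑ d ∈ P.support, P.coeff d * (z.1 ^ d 0 * z.2 ^ d 1) := by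
    funext z; rw [hF, monomial_expansion]
  rw [hF']
  have : ∀ s ⊆ P.support, p fun z => ∑ d ∈ s, P.coeff d * (z.1 ^ d 0 * z.2 ^ d 1) := by
    intro s
    classical
    induction s using Finset.induction_on with
    | empty => intro _; simpa using zero
    | insert a s ha ih =>
      intro hs
      simp_rw [Finset.sum_insert ha, add_comm (P.coeff a * _)]
      refine add _ _ _ (ih fun d hd => hs (Finset.mem_insert_of_mem hd)) (mon _ _ ?_)
      exact (degree_le_of_mem_support (hs (Finset.mem_insert_self _ _))).trans hP
  exact this _ subset_rfl

theorem comp_chord {n : ℕ} {F : ℝ × ℝ → ℝ} (hF : IsPoly n F) (θ : ℝ) :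
    IsPoly n fun z => F (chord θ z.1 z.2) := by
  refine induction_monomial (p := fun F => IsPoly n fun z => F (chord θ z.1 z.2)) ?_ ?_ ?_ hF
  · exact const n 0
  · intro c F G hF hG
    exact hF.add (hG.const_mul c)
  · intro a b hab
    have h1 : IsPoly 1 fun z => (chord θ z.1 z.2).1 := by
      have := (fst.const_mul (Real.cos θ)).sub (snd.const_mul (Real.sin θ))
      simpa [chord, mul_comm] using this
    have h2 : IsPoly 1 fun z => (chord θ z.1 z.2).2 := by
      have := (fst.const_mul (Real.sin θ)).add (snd.const_mul (Real.cos θ))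
      simpa [chord, mul_comm] using this
    exact ((h1.pow a).mul (h2.pow b)).mono (by omega)

end IsPoly

/-! ### The measure on the disk -/

theorem measurableSet_disk : MeasurableSet disk :=
  measurableSet_le (by fun_prop) (by fun_prop)

theorem measurable_weight (μ : ℝ) : Measurable (weight μ) := by
  unfold weight; fun_prop

theorem weight_nonneg (μ : ℝ) {p : ℝ × ℝ} (hp : p ∈ disk) : 0 ≤ weight μ p :=
  Real.rpow_nonneg (by have : p.1 ^ 2 + p.2 ^ 2 ≤ 1 := hp; linarith) _

theorem aConst_pos {μ : ℝ} (hμ : 0 ≤ μ) : 0 < aConst μ := by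
  unfold aConst; positivity

theorem integral_diskMeasure {μ : ℝ} (hμ : 0 ≤ μ) (F : ℝ × ℝ → ℝ) :
    ∫ p, F p ∂(diskMeasure μ) = aConst μ * ∫ p in disk, F p * weight μ p := by
  rw [diskMeasure, integral_withDensity_eq_integral_toReal_smul
    ((measurable_weight μ).const_mul _).ennreal_ofReal (Filter.Eventually.of_forall fun p =>
      ENNReal.ofReal_lt_top), ← integral_const_mul]
  refine setIntegral_congr_fun measurableSet_disk fun p hp => ?_
  simp only [smul_eq_mul]
  rw [ENNReal.toReal_ofReal (mul_nonneg (aConst_pos hμ).le (weight_nonneg μ hp))]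
  ring

theorem integrable_diskMeasure_iff {μ : ℝ} (hμ : 0 ≤ μ) (F : ℝ × ℝ → ℝ) :
    Integrable F (diskMeasure μ) ↔ IntegrableOn (fun p => F p * weight μ p) disk := by
  rw [diskMeasure, integrable_withDensity_iff_integrable_smul'
    ((measurable_weight μ).const_mul _).ennreal_ofReal (Filter.Eventually.of_forall fun p =>
      ENNReal.ofReal_lt_top), IntegrableOn]
  have h : (fun p => (ENNReal.ofReal (aConst μ * weight μ p)).toReal • F p)
      =ᵐ[volume.restrict disk] fun p => aConst μ * (F p * weight μ p) := by
    filter_upwards [ae_restrict_mem measurableSet_disk] with p hp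
    rw [ENNReal.toReal_ofReal (mul_nonneg (aConst_pos hμ).le (weight_nonneg μ hp)), smul_eq_mul]
    ring
  rw [integrable_congr h, integrable_const_mul_iff (aConst_pos hμ).ne'.isUnit]

/-! ### Polar coordinates -/

/-- An integral over the disk that separates in polar coordinates. -/
theorem setIntegral_disk_polar {μ : ℝ} (F : ℝ × ℝ → ℝ) (g A : ℝ → ℝ)
    (hF : ∀ r φ, F (r * Real.cos φ, r * Real.sin φ) = g r * A φ) :
    ∫ p in disk, F p * weight μ p =
      (∫ r in Set.Ioo (0 : ℝ) 1, r * (g r * (1 - r ^ 2) ^ (μ - 1 / 2))) *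
        ∫ φ in (-Real.pi)..Real.pi, A φ := by
  rw [← integral_indicator measurableSet_disk, ← integral_comp_polarCoord_symm, polarCoord_target,
    intervalIntegral.integral_of_le (by linarith [Real.pi_pos]), integral_Ioc_eq_integral_Ioo]
  have h1 : (∫ r in Set.Ioo (0 : ℝ) 1, r * (g r * (1 - r ^ 2) ^ (μ - 1 / 2))) =
      ∫ r in Set.Ioi (0 : ℝ), (Set.Ioc (0 : ℝ) 1).indicator
        (fun r => r * (g r * (1 - r ^ 2) ^ (μ - 1 / 2))) r := by
    rw [setIntegral_indicator measurableSet_Ioc, ← integral_Ioc_eq_integral_Ioo]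
    congr 2
    ext r; simp
  rw [h1, Measure.volume_eq_prod, ← setIntegral_prod_mul]
  refine setIntegral_congr_fun (measurableSet_Ioi.prod measurableSet_Ioo) fun p hp => ?_
  have hp0 : 0 < p.1 := hp.1
  have hs : (p.1 * Real.cos p.2) ^ 2 + (p.1 * Real.sin p.2) ^ 2 = p.1 ^ 2 := by
    have := Real.cos_sq_add_sin_sq p.2
    linear_combination p.1 ^ 2 * this
  simp only [polarCoord_symm_apply, smul_eq_mul]
  by_cases hp1 : p.1 ≤ 1
  · rw [Set.indicator_of_mem, Set.indicator_of_mem, hF, weight]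
    · simp only
      rw [show 1 - (p.1 * Real.cos p.2) ^ 2 - (p.1 * Real.sin p.2) ^ 2 = 1 - p.1 ^ 2 by linarith]
      ring
    · exact ⟨hp0, hp1⟩
    · change (p.1 * Real.cos p.2) ^ 2 + (p.1 * Real.sin p.2) ^ 2 ≤ 1
      rw [hs]; nlinarith
  · rw [Set.indicator_of_notMem, Set.indicator_of_notMem]
    · simp
    · exact fun h => hp1 h.2
    · intro h
      change (p.1 * Real.cos p.2) ^ 2 + (p.1 * Real.sin p.2) ^ 2 ≤ 1 at h
      rw [hs] at h
      nlinarith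

/-- The substitution `t = 2r² - 1` turns radial integrals into Jacobi integrals. -/
theorem radial_integral (μ : ℝ) (b : ℕ) (G : ℝ → ℝ) :
    ∫ r in Set.Ioo (0 : ℝ) 1, r * ((r ^ 2) ^ b * G (2 * r ^ 2 - 1) * (1 - r ^ 2) ^ (μ - 1 / 2)) =
      1 / 4 * (1 / 2) ^ b * (1 / 2) ^ (μ - 1 / 2) * jacobiInt (μ - 1 / 2) b G := by
  have himg : (fun r : ℝ => 2 * r ^ 2 - 1) '' Set.Ioo 0 1 = Set.Ioo (-1) 1 := by
    ext t
    constructor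
    · rintro ⟨r, ⟨h0, h1⟩, rfl⟩
      constructor <;> simp only <;> nlinarith
    · rintro ⟨h0, h1⟩
      refine ⟨√((1 + t) / 2), ⟨Real.sqrt_pos.2 (by linarith), ?_⟩, ?_⟩
      · rw [Real.sqrt_lt' one_pos]; linarith
      · simp only
        rw [Real.sq_sqrt (by linarith)]; ring
  have hinj : Set.InjOn (fun r : ℝ => 2 * r ^ 2 - 1) (Set.Ioo 0 1) := by
    intro r hr s hs h
    simp only at h
    have : (r - s) * (r + s) = 0 := by linarith
    rcases mul_eq_zero.1 this with h | h
    · linarith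
    · linarith [hr.1, hs.1]
  have hsub := integral_image_eq_integral_abs_deriv_smul (f' := fun r : ℝ => 4 * r)
    (measurableSet_Ioo : MeasurableSet (Set.Ioo (0 : ℝ) 1))
    (fun r _ => by
      have h := (((hasDerivAt_id r).pow 2).const_mul (2 : ℝ)).sub_const 1
      refine (h.congr_deriv ?_).hasDerivWithinAt
      simp; ring) hinj (fun t => G t * jacobiWeight (μ - 1 / 2) b t)
  rw [jacobiInt, ← himg, hsub, ← integral_const_mul]
  refine setIntegral_congr_fun measurableSet_Ioo fun r hr => ?_
  have h1 : 0 ≤ 1 - r ^ 2 := by nlinarith [hr.1, hr.2]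
  simp only [smul_eq_mul, jacobiWeight]
  rw [show 1 - (2 * r ^ 2 - 1) = 2 * (1 - r ^ 2) by ring,
    show 1 + (2 * r ^ 2 - 1) = 2 * r ^ 2 by ring,
    Real.mul_rpow (by norm_num) h1, Real.rpow_natCast, mul_pow, abs_of_pos (by linarith [hr.1])]
  have h2 : ((1 : ℝ) / 2) ^ (μ - 1 / 2) * 2 ^ (μ - 1 / 2) = 1 := by
    rw [← Real.mul_rpow (by norm_num) (by norm_num)]; norm_num
  have h3 : ((1 : ℝ) / 2) ^ b * 2 ^ b = 1 := by rw [← mul_pow]; norm_num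
  linear_combination (-r * (r ^ 2) ^ b * G (2 * r ^ 2 - 1) * (1 - r ^ 2) ^ (μ - 1 / 2)) *
    (((1 : ℝ) / 2) ^ b * 2 ^ b * h2 + h3)

/-- The constant `a_μ` makes the measure on the disk a probability measure. That the total mass is
not the junk value `0` of a divergent integral gives integrability. -/
theorem integrableOn_weight {μ : ℝ} (hμ : 0 ≤ μ) :
    IntegrableOn (weight μ) disk ∧ aConst μ * ∫ p in disk, weight μ p = 1 := by
  have h := setIntegral_disk_polar (μ := μ) (fun _ => 1) (fun r => (r ^ 2) ^ 0 * 1) (fun _ => 1)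
    (by simp)
  have h2 := radial_integral μ 0 (fun _ => 1)
  have hI : jacobiInt (μ - 1 / 2) (0 : ℕ) (fun _ => 1) = 2 ^ (μ - 1 / 2) * (2 / (μ + 1 / 2)) := by
    simp only [jacobiInt, one_mul]
    rw [(integral_jacobiWeight (by linarith) (by simp)).2]
    have h3 : ProbabilityTheory.beta (μ - 1 / 2 + 1) ((0 : ℕ) + 1) = 1 / (μ + 1 / 2) := by
      rw [ProbabilityTheory.beta]
      push_cast
      rw [show μ - 1 / 2 + 1 = μ + 1 / 2 by ring, zero_add, Real.Gamma_add_one (by positivity),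
        Real.Gamma_one]
      have := (Real.Gamma_pos_of_pos (by positivity : 0 < μ + 1 / 2)).ne'
      field_simp
    rw [h3]
    push_cast
    rw [add_zero, Real.rpow_add_one (by norm_num)]
    ring
  rw [h2, hI] at h
  have h4 : ((1 : ℝ) / 2) ^ (μ - 1 / 2) * 2 ^ (μ - 1 / 2) = 1 := by
    rw [← Real.mul_rpow (by norm_num) (by norm_num)]; norm_num
  have h5 : aConst μ * ∫ p in disk, weight μ p = 1 := by
    simp only [one_mul] at h
    rw [h, aConst]
    simp only [pow_zero, mul_one, intervalIntegral.integral_const, smul_eq_mul]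
    have : μ + 1 / 2 ≠ 0 := by positivity
    have := Real.pi_pos.ne'
    calc _ = ((1 : ℝ) / 2) ^ (μ - 1 / 2) * 2 ^ (μ - 1 / 2) *
          ((μ + 1 / 2) / Real.pi * (1 / 4 * (2 / (μ + 1 / 2)) * (Real.pi - -Real.pi))) := by ring
      _ = 1 := by rw [h4]; field_simp; ring
  refine ⟨?_, h5⟩
  refine not_imp_comm.1 integral_undef ?_
  intro h6
  rw [h6, mul_zero] at h5
  exact zero_ne_one h5

theorem isFiniteMeasure_diskMeasure {μ : ℝ} (hμ : 0 ≤ μ) : IsFiniteMeasure (diskMeasure μ) := by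
  have h : Integrable (fun _ : ℝ × ℝ => (1 : ℝ)) (diskMeasure μ) := by
    rw [integrable_diskMeasure_iff hμ]
    simpa using (integrableOn_weight hμ).1
  simpa [integrable_const_iff] using h

theorem isCompact_disk : IsCompact disk := by
  refine (isCompact_Icc (a := ((-1 : ℝ), (-1 : ℝ))) (b := (1, 1))).of_isClosed_subset
    (isClosed_le (by fun_prop) (by fun_prop)) ?_
  intro p hp
  have hp : p.1 ^ 2 + p.2 ^ 2 ≤ 1 := hp
  simp only [Set.mem_Icc, Prod.le_def]
  refine ⟨⟨?_, ?_⟩, ?_, ?_⟩ <;> nlinarith [sq_nonneg p.1, sq_nonneg p.2]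

theorem ae_mem_disk (μ : ℝ) : ∀ᵐ p ∂(diskMeasure μ), p ∈ disk :=
  (withDensity_absolutelyContinuous _ _).ae_le (ae_restrict_mem measurableSet_disk)

theorem memLp_of_continuous {μ : ℝ} (hμ : 0 ≤ μ) {F : ℝ × ℝ → ℝ} (hF : Continuous F)
    (q : ENNReal) : MemLp F q (diskMeasure μ) := by
  have := isFiniteMeasure_diskMeasure hμ
  obtain ⟨C, hC⟩ := isCompact_disk.exists_bound_of_continuousOn hF.continuousOn
  refine MemLp.of_bound hF.aestronglyMeasurable C ?_
  filter_upwards [ae_mem_disk μ] with p hp using hC p hp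

theorem integrable_of_continuous {μ : ℝ} (hμ : 0 ≤ μ) {F : ℝ × ℝ → ℝ} (hF : Continuous F) :
    Integrable F (diskMeasure μ) :=
  memLp_one_iff_integrable.1 (memLp_of_continuous hμ hF 1)

/-! ### Angular integrals -/

theorem integral_cos_sin_int_mul (z : ℤ) :
    (z ≠ 0 → ∫ φ in (-Real.pi)..Real.pi, Real.cos (z * φ) = 0) ∧
    ∫ φ in (-Real.pi)..Real.pi, Real.sin (z * φ) = 0 := by
  constructor
  · intro hz
    have hz' : (z : ℝ) ≠ 0 := by exact_mod_cast hz
    rw [intervalIntegral.integral_comp_mul_left (fun x => Real.cos x) hz', integral_cos]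
    simp [Real.sin_int_mul_pi]
  · rcases eq_or_ne z 0 with rfl | hz
    · simp
    have hz' : (z : ℝ) ≠ 0 := by exact_mod_cast hz
    rw [intervalIntegral.integral_comp_mul_left (fun x => Real.sin x) hz', integral_sin]
    simp

/-- `cos^a sin^b` is orthogonal to `cos (zφ)` and `sin (zφ)` unless `|z| ≤ a + b` and `z` has the
parity of `a + b`. -/
theorem integral_trig_mul_pow (a b : ℕ) : ∀ z : ℤ,
    (((a + b : ℕ) : ℤ) < |z| ∨ ¬ (2 ∣ z + (a + b : ℕ))) →
    (∫ φ in (-Real.pi)..Real.pi, Real.cos (z * φ) * (Real.cos φ ^ a * Real.sin φ ^ b) = 0) ∧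
    ∫ φ in (-Real.pi)..Real.pi, Real.sin (z * φ) * (Real.cos φ ^ a * Real.sin φ ^ b) = 0 := by
  have hcond : ∀ (n : ℕ) (z : ℤ), (((n + 1 : ℕ) : ℤ) < |z| ∨ ¬ (2 ∣ z + (n + 1 : ℕ))) →
      ((n : ℤ) < |z + 1| ∨ ¬ (2 ∣ z + 1 + n)) ∧ ((n : ℤ) < |z - 1| ∨ ¬ (2 ∣ z - 1 + n)) := by
    intro n z h
    push_cast at h
    rcases abs_cases z with hz | hz <;> rcases abs_cases (z + 1) with h1 | h1 <;>
      rcases abs_cases (z - 1) with h2 | h2 <;> omega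
  induction a with
  | zero =>
    induction b with
    | zero =>
      intro z hz
      have h := integral_cos_sin_int_mul z
      simp only [pow_zero, mul_one]
      refine ⟨h.1 ?_, h.2⟩
      rintro rfl
      simp at hz
    | succ b ih =>
      intro z hz
      obtain ⟨h1, h2⟩ := hcond (0 + b) z (by simpa [add_assoc] using hz)
      have h1 := ih (z + 1) h1
      have h2 := ih (z - 1) h2
      push_cast at h1 h2
      constructor
      · rw [show (fun φ : ℝ => Real.cos (z * φ) * (Real.cos φ ^ 0 * Real.sin φ ^ (b + 1))) =
          fun φ => 1 / 2 * (Real.sin ((z + 1) * φ) * (Real.cos φ ^ 0 * Real.sin φ ^ b)) -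
            1 / 2 * (Real.sin ((z - 1) * φ) * (Real.cos φ ^ 0 * Real.sin φ ^ b)) by
          funext φ
          rw [add_mul, sub_mul, one_mul, Real.sin_add, Real.sin_sub]; ring]
        rw [intervalIntegral.integral_sub
          (Continuous.intervalIntegrable (by fun_prop) _ _)
          (Continuous.intervalIntegrable (by fun_prop) _ _), intervalIntegral.integral_const_mul,
          intervalIntegral.integral_const_mul, h1.2, h2.2]
        simp
      · rw [show (fun φ : ℝ => Real.sin (z * φ) * (Real.cos φ ^ 0 * Real.sin φ ^ (b + 1))) =
          fun φ => 1 / 2 * (Real.cos ((z - 1) * φ) * (Real.cos φ ^ 0 * Real.sin φ ^ b)) -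
            1 / 2 * (Real.cos ((z + 1) * φ) * (Real.cos φ ^ 0 * Real.sin φ ^ b)) by
          funext φ
          rw [add_mul, sub_mul, one_mul, Real.cos_add, Real.cos_sub]; ring]
        rw [intervalIntegral.integral_sub
          (Continuous.intervalIntegrable (by fun_prop) _ _)
          (Continuous.intervalIntegrable (by fun_prop) _ _), intervalIntegral.integral_const_mul,
          intervalIntegral.integral_const_mul, h1.1, h2.1]
        simp
  | succ a ih =>
    intro z hz
    obtain ⟨h1, h2⟩ := hcond (a + b) z (by
      rw [show a + b + 1 = a + 1 + b by ring]; exact hz)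
    have h1 := ih (z + 1) h1
    have h2 := ih (z - 1) h2
    push_cast at h1 h2
    constructor
    · rw [show (fun φ : ℝ => Real.cos (z * φ) * (Real.cos φ ^ (a + 1) * Real.sin φ ^ b)) =
        fun φ => 1 / 2 * (Real.cos ((z + 1) * φ) * (Real.cos φ ^ a * Real.sin φ ^ b)) +
          1 / 2 * (Real.cos ((z - 1) * φ) * (Real.cos φ ^ a * Real.sin φ ^ b)) by
        funext φ
        rw [add_mul, sub_mul, one_mul, Real.cos_add, Real.cos_sub]; ring]
      rw [intervalIntegral.integral_add
        (Continuous.intervalIntegrable (by fun_prop) _ _)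
        (Continuous.intervalIntegrable (by fun_prop) _ _), intervalIntegral.integral_const_mul,
        intervalIntegral.integral_const_mul, h1.1, h2.1]
      simp
    · rw [show (fun φ : ℝ => Real.sin (z * φ) * (Real.cos φ ^ (a + 1) * Real.sin φ ^ b)) =
        fun φ => 1 / 2 * (Real.sin ((z + 1) * φ) * (Real.cos φ ^ a * Real.sin φ ^ b)) +
          1 / 2 * (Real.sin ((z - 1) * φ) * (Real.cos φ ^ a * Real.sin φ ^ b)) by
        funext φ
        rw [add_mul, sub_mul, one_mul, Real.sin_add, Real.sin_sub]; ring]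
      rw [intervalIntegral.integral_add
        (Continuous.intervalIntegrable (by fun_prop) _ _)
        (Continuous.intervalIntegrable (by fun_prop) _ _), intervalIntegral.integral_const_mul,
        intervalIntegral.integral_const_mul, h1.2, h2.2]
      simp

/-! ### The orthogonal polynomials in polar coordinates -/

/-- The polynomial `P_{l,ε}^{2l+j}`, rescaled such that on the unit circle it is `cos jφ` or
`sin jφ`. -/
def discPoly (μ : ℝ) (j l : ℕ) (ε : Fin 2) (p : ℝ × ℝ) : ℝ :=
  jacobi (μ - 1 / 2) j l (2 * (p.1 ^ 2 + p.2 ^ 2) - 1) / jacobi (μ - 1 / 2) j l 1 *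
    harmonic ε j p.1 p.2

theorem isPoly_harmonic (ε : Fin 2) (j : ℕ) : IsPoly j fun p => harmonic ε j p.1 p.2 := by
  have h : IsPoly j (fun p => harmonic 0 j p.1 p.2) ∧ IsPoly j (fun p => harmonic 1 j p.1 p.2) := by
    induction j with
    | zero => exact ⟨by simpa [harmonic] using IsPoly.const 0 1,
        by simpa [harmonic] using IsPoly.const 0 0⟩
    | succ j ih =>
      constructor
      · have := (ih.1.mul IsPoly.fst).sub (ih.2.mul IsPoly.snd)
        simpa [harmonic, pow_succ] using this
      · have := (ih.1.mul IsPoly.snd).add (ih.2.mul IsPoly.fst)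
        simpa [harmonic, pow_succ] using this
  fin_cases ε
  · exact h.1
  · exact h.2

theorem isPoly_discPoly (μ : ℝ) (j l : ℕ) (ε : Fin 2) : IsPoly (2 * l + j) (discPoly μ j l ε) := by
  obtain ⟨p, hp, hpe⟩ := exists_jacobi_poly (μ - 1 / 2) j l
  have h1 : IsPoly 2 fun p => 2 * (p.1 ^ 2 + p.2 ^ 2) - 1 :=
    (((IsPoly.fst.pow 2).add (IsPoly.snd.pow 2)).const_mul 2).sub (IsPoly.const 2 1)
  have h2 := ((IsPoly.eval p hp h1).const_mul (jacobi (μ - 1 / 2) j l 1)⁻¹).mul (isPoly_harmonic ε j)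
  rw [mul_comm l 2] at h2
  convert h2 using 2 with z
  rw [discPoly, hpe]
  ring

/-- In polar coordinates, a monomial of degree less than `2l + j` is orthogonal to `discPoly` either
by its angular part, or because its radial part is `r^j` times a polynomial in `r²` of degree less
than `l`. -/
theorem integral_discPoly_mul_monomial {μ : ℝ} (hμ : 0 ≤ μ) (j l : ℕ) (ε : Fin 2) (a b : ℕ)
    (hab : a + b < 2 * l + j) :
    ∫ p in disk, discPoly μ j l ε p * (p.1 ^ a * p.2 ^ b) * weight μ p = 0 := by
  have hpol := setIntegral_disk_polar (μ := μ)
    (fun p => discPoly μ j l ε p * (p.1 ^ a * p.2 ^ b))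
    (fun r => (r ^ (j + (a + b))) * (jacobi (μ - 1 / 2) j l (2 * r ^ 2 - 1) /
      jacobi (μ - 1 / 2) j l 1))
    (fun φ => (if ε = 0 then Real.cos (((j : ℤ) : ℝ) * φ) else Real.sin (((j : ℤ) : ℝ) * φ)) *
      (Real.cos φ ^ a * Real.sin φ ^ b)) (by
      intro r φ
      rw [discPoly, harmonic_polar]
      have hs : (r * Real.cos φ) ^ 2 + (r * Real.sin φ) ^ 2 = r ^ 2 := by
        have := Real.cos_sq_add_sin_sq φ
        linear_combination r ^ 2 * this
      simp only [hs]
      push_cast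
      ring)
  rw [hpol]
  by_cases hc : ((a + b : ℕ) : ℤ) < |(j : ℤ)| ∨ ¬ (2 ∣ (j : ℤ) + (a + b : ℕ))
  · have h := integral_trig_mul_pow a b j hc
    have : ∫ φ in (-Real.pi)..Real.pi, (if ε = 0 then Real.cos (((j : ℤ) : ℝ) * φ) else
        Real.sin (((j : ℤ) : ℝ) * φ)) * (Real.cos φ ^ a * Real.sin φ ^ b) = 0 := by
      split_ifs
      · exact h.1
      · exact h.2
    rw [this, mul_zero]
  · have : ∃ i, a + b = j + 2 * i ∧ i < l := by
      refine ⟨(a + b - j) / 2, ?_, ?_⟩ <;> rw [Nat.abs_cast] at hc <;> omega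
    obtain ⟨i, hi, hil⟩ := this
    have hrad := radial_integral μ j (fun t => jacobi (μ - 1 / 2) j l t *
      ((jacobi (μ - 1 / 2) j l 1)⁻¹ * ((1 + t) / 2) ^ i))
    have hz := jacobiInt_jacobi_mul_eval_eq_zero (α := μ - 1 / 2) (β := j) (by linarith)
      (by linarith [Nat.cast_nonneg (α := ℝ) j])
      (by linarith [Nat.cast_nonneg (α := ℝ) j]) (n := l)
      (Polynomial.C (jacobi (μ - 1 / 2) j l 1)⁻¹ *
        (Polynomial.C (1 / 2) + Polynomial.C (1 / 2) * Polynomial.X) ^ i) (by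
        refine (Polynomial.natDegree_C_mul_le _ _).trans_lt
          ((Polynomial.natDegree_pow_le_of_le i (?_ : _ ≤ 1)).trans_lt (by simpa using hil))
        compute_degree)
    have hz' : jacobiInt (μ - 1 / 2) j (fun t => jacobi (μ - 1 / 2) j l t *
      ((jacobi (μ - 1 / 2) j l 1)⁻¹ * ((1 + t) / 2) ^ i)) = 0 := by
      rw [← hz]
      congr 1
      funext t
      simp only [Polynomial.eval_mul, Polynomial.eval_C, Polynomial.eval_pow, Polynomial.eval_add,
        Polynomial.eval_X]
      rw [show 1 / 2 + 1 / 2 * t = (1 + t) / 2 by ring]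
    rw [hz', mul_zero] at hrad
    refine mul_eq_zero_of_left (Eq.trans ?_ hrad) _
    refine setIntegral_congr_fun measurableSet_Ioo fun r _ => ?_
    rw [hi, show (1 + (2 * r ^ 2 - 1)) / 2 = r ^ 2 by ring,
      show j + (j + 2 * i) = 2 * j + 2 * i by ring,
      pow_add, pow_mul, pow_mul]
    ring

/-- `discPoly` belongs to `V_{2l+j}²(W_μ)`. -/
theorem integral_discPoly_mul {μ : ℝ} (hμ : 0 ≤ μ) (j l : ℕ) (ε : Fin 2) {n : ℕ}
    (hn : n < 2 * l + j) {G : ℝ × ℝ → ℝ} (hG : IsPoly n G) :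
    ∫ p, discPoly μ j l ε p * G p ∂(diskMeasure μ) = 0 := by
  have hB := (isPoly_discPoly μ j l ε).continuous
  refine (IsPoly.induction_monomial (p := fun G => Continuous G ∧
    ∫ p, discPoly μ j l ε p * G p ∂(diskMeasure μ) = 0) ?_ ?_ ?_ hG).2
  · exact ⟨continuous_const, by simp⟩
  · rintro c F G ⟨hF, hF0⟩ ⟨hG, hG0⟩
    refine ⟨hF.add (hG.const_mul c), ?_⟩
    simp_rw [mul_add, mul_left_comm _ c]
    have h1 : Integrable (fun p => discPoly μ j l ε p * F p) (diskMeasure μ) :=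
      integrable_of_continuous hμ (hB.mul hF)
    have h2 : Integrable (fun p => discPoly μ j l ε p * G p) (diskMeasure μ) :=
      integrable_of_continuous hμ (hB.mul hG)
    rw [integral_add h1 (h2.const_mul c), integral_const_mul, hF0, hG0]
    simp
  · intro a b hab
    refine ⟨by fun_prop, ?_⟩
    rw [integral_diskMeasure hμ, integral_discPoly_mul_monomial hμ j l ε a b (by omega), mul_zero]

/-! ### Rotation and Fubini -/

/-- The rotation `(t, s) ↦ chord θ t s` of the plane. -/
def chordEquiv (θ : ℝ) : ℝ × ℝ ≃ᵐ ℝ × ℝ :=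
  (Complex.measurableEquivRealProd.symm.trans
    (rotation (Circle.exp θ)).toHomeomorph.toMeasurableEquiv).trans Complex.measurableEquivRealProd

theorem chordEquiv_apply (θ : ℝ) (p : ℝ × ℝ) : chordEquiv θ p = chord θ p.1 p.2 := by
  simp only [chordEquiv, MeasurableEquiv.trans_apply, Complex.measurableEquivRealProd_apply,
    Homeomorph.toMeasurableEquiv_coe, chord]
  change ((rotation (Circle.exp θ) (Complex.measurableEquivRealProd.symm p)).re,
    (rotation (Circle.exp θ) (Complex.measurableEquivRealProd.symm p)).im) = _
  rw [rotation_apply, Circle.coe_exp, Complex.mul_re, Complex.mul_im,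
    Complex.exp_ofReal_mul_I_re, Complex.exp_ofReal_mul_I_im]
  ext <;> simp [Complex.measurableEquivRealProd] <;> ring

theorem measurePreserving_chordEquiv (θ : ℝ) :
    MeasurePreserving (chordEquiv θ) volume volume := by
  have h := (rotation (Circle.exp θ)).measurePreserving
  exact Complex.volume_preserving_equiv_real_prod.comp
    (h.comp (Complex.volume_preserving_equiv_real_prod.symm _))

theorem chord_sq (θ t s : ℝ) : (chord θ t s).1 ^ 2 + (chord θ t s).2 ^ 2 = t ^ 2 + s ^ 2 := by
  have := Real.cos_sq_add_sin_sq θ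
  simp only [chord]
  linear_combination (t ^ 2 + s ^ 2) * this

theorem weight_chord (μ θ t s : ℝ) : weight μ (chord θ t s) = (1 - t ^ 2 - s ^ 2) ^ (μ - 1 / 2) := by
  rw [weight, sub_sub, chord_sq, sub_sub]

theorem chordEquiv_preimage_disk (θ : ℝ) : chordEquiv θ ⁻¹' disk = disk := by
  ext p
  change (chordEquiv θ p).1 ^ 2 + (chordEquiv θ p).2 ^ 2 ≤ 1 ↔ p.1 ^ 2 + p.2 ^ 2 ≤ 1
  rw [chordEquiv_apply, chord_sq]

/-- The sections of the disk. -/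
theorem indicator_disk_section (H : ℝ × ℝ → ℝ) {t : ℝ} (ht : t ∈ Set.Icc (-1 : ℝ) 1) :
    (fun s => disk.indicator H (t, s)) =
      (Set.Icc (-√(1 - t ^ 2)) √(1 - t ^ 2)).indicator fun s => H (t, s) := by
  have ht2 : 0 ≤ 1 - t ^ 2 := by nlinarith [ht.1, ht.2]
  funext s
  have hiff : (t, s) ∈ disk ↔ s ∈ Set.Icc (-√(1 - t ^ 2)) √(1 - t ^ 2) := by
    rw [Set.mem_Icc, ← abs_le, ← Real.sqrt_sq_eq_abs, Real.sqrt_le_sqrt_iff ht2]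
    change t ^ 2 + s ^ 2 ≤ 1 ↔ _
    constructor <;> intro h <;> linarith
  by_cases h : (t, s) ∈ disk
  · rw [Set.indicator_of_mem h, Set.indicator_of_mem (hiff.1 h)]
  · rw [Set.indicator_of_notMem h, Set.indicator_of_notMem fun h' => h (hiff.2 h')]

theorem indicator_disk_section_of_notMem (H : ℝ × ℝ → ℝ) {t : ℝ} (ht : t ∉ Set.Icc (-1 : ℝ) 1)
    (s : ℝ) : disk.indicator H (t, s) = 0 := by
  refine Set.indicator_of_notMem (fun h => ht ?_) _
  have h : t ^ 2 + s ^ 2 ≤ 1 := h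
  constructor <;> nlinarith [sq_nonneg s]

/-- Fubini's theorem along the chords orthogonal to the direction `θ`. -/
theorem radon_fubini (μ : ℝ) {F : ℝ × ℝ → ℝ} (θ : ℝ)
    (hF : IntegrableOn (fun p => F p * weight μ p) disk) :
    (∀ᵐ t ∂(volume.restrict (Set.Icc (-1 : ℝ) 1)), IntervalIntegrable
        (radonIntegrand μ F θ t) volume (-√(1 - t ^ 2)) √(1 - t ^ 2)) ∧
    IntegrableOn (radon μ F θ) (Set.Icc (-1) 1) ∧
    ∫ t in Set.Icc (-1 : ℝ) 1, radon μ F θ t = ∫ p in disk, F p * weight μ p := by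
  set H : ℝ × ℝ → ℝ := fun p => radonIntegrand μ F θ p.1 p.2 with hH
  have hHe : H = (fun p => F p * weight μ p) ∘ chordEquiv θ := by
    funext p
    simp only [hH, radonIntegrand, Function.comp, chordEquiv_apply]
  have hHi : IntegrableOn H disk := by
    rw [hHe]
    have := (measurePreserving_chordEquiv θ).integrableOn_comp_preimage
      (chordEquiv θ).measurableEmbedding (f := fun p => F p * weight μ p) (s := disk)
    rw [chordEquiv_preimage_disk] at this
    exact this.2 hF
  have hHint : ∫ p in disk, H p = ∫ p in disk, F p * weight μ p := by
    have := (measurePreserving_chordEquiv θ).setIntegral_preimage_emb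
      (chordEquiv θ).measurableEmbedding (fun p => F p * weight μ p) disk
    rw [chordEquiv_preimage_disk] at this
    rw [← this, hHe]
    rfl
  have hI : Integrable (disk.indicator H) ((volume : Measure ℝ).prod volume) :=
    (integrable_indicator_iff measurableSet_disk).2 hHi
  have hsec : ∀ t, ∫ s, disk.indicator H (t, s) =
      (Set.Icc (-1 : ℝ) 1).indicator (radon μ F θ) t := by
    intro t
    by_cases ht : t ∈ Set.Icc (-1 : ℝ) 1
    · rw [Set.indicator_of_mem ht, indicator_disk_section H ht, integral_indicator measurableSet_Icc,
        radon, intervalIntegral.integral_of_le (by linarith [Real.sqrt_nonneg (1 - t ^ 2)]),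
        integral_Icc_eq_integral_Ioc]
    · rw [Set.indicator_of_notMem ht]
      simp_rw [indicator_disk_section_of_notMem H ht]
      simp
  refine ⟨?_, ?_, ?_⟩
  · rw [ae_restrict_iff' measurableSet_Icc]
    filter_upwards [hI.prod_right_ae] with t hti ht
    rw [indicator_disk_section H ht, integrable_indicator_iff measurableSet_Icc] at hti
    exact (intervalIntegrable_iff_integrableOn_Icc_of_le
      (by linarith [Real.sqrt_nonneg (1 - t ^ 2)])).2 hti
  · have h := hI.integral_prod_left
    simp_rw [hsec] at h
    exact (integrable_indicator_iff measurableSet_Icc).1 h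
  · rw [← hHint, ← integral_indicator measurableSet_disk, Measure.volume_eq_prod,
      integral_prod _ hI, ← integral_indicator measurableSet_Icc]
    simp_rw [hsec]

/-- A ridge function `p ↦ g(⟨p, (cos θ, sin θ)⟩)` is constant on the chords orthogonal to `θ`. -/
theorem radon_mul_ridge (μ : ℝ) (F : ℝ × ℝ → ℝ) (g : ℝ → ℝ) (θ t : ℝ) :
    radon μ (fun p => F p * g (p.1 * Real.cos θ + p.2 * Real.sin θ)) θ t =
      radon μ F θ t * g t := by
  rw [radon, radon, ← intervalIntegral.integral_mul_const]
  congr 1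
  funext s
  have : (chord θ t s).1 * Real.cos θ + (chord θ t s).2 * Real.sin θ = t := by
    have := Real.cos_sq_add_sin_sq θ
    simp only [chord]
    linear_combination t * this
  simp only [radonIntegrand, this]
  ring

/-- Integrating the Radon projection in the direction `θ` against a profile `g` amounts to
integrating the function against the ridge function of `g`. -/
theorem radon_ridge_fubini {μ : ℝ} (hμ : 0 ≤ μ) {F : ℝ × ℝ → ℝ} (hF : Integrable F (diskMeasure μ))
    {g : ℝ → ℝ} (hg : Continuous g) (θ : ℝ) :
    IntegrableOn (fun t => radon μ F θ t * g t) (Set.Icc (-1) 1) ∧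
    aConst μ * ∫ t in Set.Icc (-1 : ℝ) 1, radon μ F θ t * g t =
      ∫ p, F p * g (p.1 * Real.cos θ + p.2 * Real.sin θ) ∂(diskMeasure μ) := by
  have hc : Continuous fun p : ℝ × ℝ => g (p.1 * Real.cos θ + p.2 * Real.sin θ) :=
    hg.comp (by fun_prop)
  have hFg : Integrable (fun p => F p * g (p.1 * Real.cos θ + p.2 * Real.sin θ))
      (diskMeasure μ) := by
    obtain ⟨C, hC⟩ := isCompact_disk.exists_bound_of_continuousOn hc.continuousOn
    refine hF.mul_bdd (c := C) hc.aestronglyMeasurable ?_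
    filter_upwards [ae_mem_disk μ] with p hp using hC p hp
  obtain ⟨-, h2, h3⟩ := radon_fubini μ θ ((integrable_diskMeasure_iff hμ _).1 hFg)
  have he : radon μ (fun p => F p * g (p.1 * Real.cos θ + p.2 * Real.sin θ)) θ =
      fun t => radon μ F θ t * g t := funext fun t => radon_mul_ridge μ F g θ t
  rw [he] at h2 h3
  exact ⟨h2, by rw [h3, integral_diskMeasure hμ]⟩

/-- The substitution `s = √(1 - t²) σ` in the attenuated Radon projection. -/
theorem radon_eq_jacobiInt (μ : ℝ) (F : ℝ × ℝ → ℝ) (θ : ℝ) {t : ℝ} (ht : t ∈ Set.Ioo (-1 : ℝ) 1) :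
    radon μ F θ t = jacobiWeight μ μ t *
      jacobiInt (μ - 1 / 2) (μ - 1 / 2) fun σ => F (chord θ t (√(1 - t ^ 2) * σ)) := by
  have ht2 : 0 < 1 - t ^ 2 := by nlinarith [ht.1, ht.2]
  have hc := Real.sqrt_pos.2 ht2
  have hsub := intervalIntegral.integral_comp_mul_left (a := -1) (b := 1) (radonIntegrand μ F θ t)
    hc.ne'
  rw [mul_neg, mul_one, smul_eq_mul] at hsub
  have hw : jacobiWeight μ μ t = √(1 - t ^ 2) * (1 - t ^ 2) ^ (μ - 1 / 2) := by
    rw [jacobiWeight, ← Real.mul_rpow (by linarith [ht.2]) (by linarith [ht.1]),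
      Real.sqrt_eq_rpow, ← Real.rpow_add ht2]
    congr 1 <;> ring
  have h1 : radon μ F θ t = √(1 - t ^ 2) *
      ∫ σ in (-1 : ℝ)..1, radonIntegrand μ F θ t (√(1 - t ^ 2) * σ) := by
    rw [hsub, radon, mul_inv_cancel_left₀ hc.ne']
  rw [h1, hw, intervalIntegral.integral_of_le (by norm_num), integral_Ioc_eq_integral_Ioo, mul_assoc,
    jacobiInt, ← integral_const_mul ((1 - t ^ 2) ^ (μ - 1 / 2))]
  congr 1
  refine setIntegral_congr_fun measurableSet_Ioo fun σ hσ => ?_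
  simp only [radonIntegrand, weight_chord, jacobiWeight]
  rw [← Real.mul_rpow (by linarith [hσ.2]) (by linarith [hσ.1]), mul_pow, Real.sq_sqrt ht2.le,
    show 1 - t ^ 2 - (1 - t ^ 2) * σ ^ 2 = (1 - t ^ 2) * ((1 - σ) * (1 + σ)) by ring,
    Real.mul_rpow ht2.le (by nlinarith [hσ.1, hσ.2])]
  ring

theorem jacobiInt_odd_pow (α : ℝ) {b : ℕ} (hb : Odd b) : jacobiInt α α (fun σ => σ ^ b) = 0 := by
  have h : jacobiInt α α (fun σ => σ ^ b) = -jacobiInt α α (fun σ => σ ^ b) := by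
    conv_lhs => rw [jacobiInt, ← integral_Ioc_eq_integral_Ioo,
      ← intervalIntegral.integral_of_le (by norm_num), ← neg_neg (1 : ℝ),
      ← intervalIntegral.integral_comp_neg, neg_neg,
      intervalIntegral.integral_of_le (by norm_num), integral_Ioc_eq_integral_Ioo]
    rw [jacobiInt, ← integral_neg]
    congr 1
    funext σ
    rw [hb.neg_pow, jacobiWeight, jacobiWeight, sub_neg_eq_add, ← sub_eq_add_neg]
    ring
  linarith

open Polynomial in
/-- Marr's theorem: the Radon projection of a polynomial of degree at most `n` is the weight
`(1 - t²)^μ` times a polynomial of degree at most `n`, whose value at `t = 1` is a multiple of the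
value of the given polynomial at the point where the chord degenerates. -/
theorem exists_radon_poly {μ : ℝ} (hμ : 0 ≤ μ) {n : ℕ} {F : ℝ × ℝ → ℝ} (hF : IsPoly n F) (θ : ℝ) :
    ∃ q : ℝ[X], q.natDegree ≤ n ∧
      q.eval 1 = F (Real.cos θ, Real.sin θ) * jacobiInt (μ - 1 / 2) (μ - 1 / 2) (fun _ => 1) ∧
      ∀ t ∈ Set.Ioo (-1 : ℝ) 1, radon μ F θ t = q.eval t * jacobiWeight μ μ t := by
  have hα : -1 < μ - 1 / 2 := by linarith
  have key : ∀ G, IsPoly n G → Continuous G ∧ ∃ q : ℝ[X], q.natDegree ≤ n ∧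
      ∀ t ∈ Set.Icc (-1 : ℝ) 1, jacobiInt (μ - 1 / 2) (μ - 1 / 2)
        (fun σ => G (t, √(1 - t ^ 2) * σ)) = q.eval t := by
    intro G hG
    refine IsPoly.induction_monomial (p := fun G => Continuous G ∧ ∃ q : ℝ[X], q.natDegree ≤ n ∧
      ∀ t ∈ Set.Icc (-1 : ℝ) 1, jacobiInt (μ - 1 / 2) (μ - 1 / 2)
        (fun σ => G (t, √(1 - t ^ 2) * σ)) = q.eval t) ?_ ?_ ?_ hG
    · exact ⟨continuous_const, 0, by simp, fun t _ => by simp [jacobiInt]⟩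
    · rintro c F G ⟨hF, q, hq, hqe⟩ ⟨hG, r, hr, hre⟩
      refine ⟨by fun_prop, q + C c * r, (natDegree_add_le _ _).trans
        (max_le hq ((natDegree_C_mul_le _ _).trans hr)), fun t ht => ?_⟩
      have h1 := hqe t ht
      have h2 := hre t ht
      rw [eval_add, eval_mul, eval_C, ← h1, ← h2, ← jacobiInt_const_mul]
      simp only [jacobiInt, add_mul]
      exact integral_add (integrableOn_mul_jacobiWeight hα hα (by fun_prop))
        (integrableOn_mul_jacobiWeight hα hα
          (g := fun σ => c * G (t, √(1 - t ^ 2) * σ)) (by fun_prop))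
    · intro a b hab
      refine ⟨by fun_prop, ?_⟩
      have hmul : ∀ t : ℝ, jacobiInt (μ - 1 / 2) (μ - 1 / 2)
          (fun σ => t ^ a * (√(1 - t ^ 2) * σ) ^ b) = t ^ a * √(1 - t ^ 2) ^ b *
            jacobiInt (μ - 1 / 2) (μ - 1 / 2) (fun σ => σ ^ b) := by
        intro t
        rw [← jacobiInt_const_mul]
        congr 1
        funext σ
        rw [mul_pow]; ring
      rcases Nat.even_or_odd b with ⟨c, hc⟩ | hb
      · refine ⟨C (jacobiInt (μ - 1 / 2) (μ - 1 / 2) (fun σ => σ ^ b)) *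
          (X ^ a * (C 1 - X ^ 2) ^ c), ?_, fun t ht => ?_⟩
        · refine (natDegree_C_mul_le _ _).trans (natDegree_mul_le.trans ?_)
          have h1 : ((C 1 - X ^ 2 : ℝ[X]) ^ c).natDegree ≤ c * 2 :=
            natDegree_pow_le_of_le c (by compute_degree)
          have h2 : (X ^ a : ℝ[X]).natDegree ≤ a := natDegree_X_pow_le a
          omega
        · have ht2 : 0 ≤ 1 - t ^ 2 := by nlinarith [ht.1, ht.2]
          have hs : √(1 - t ^ 2) ^ b = (1 - t ^ 2) ^ c := by
            rw [hc, ← two_mul, pow_mul, Real.sq_sqrt ht2]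
          rw [hmul, hs]
          simp only [eval_mul, eval_C, eval_pow, eval_X, eval_sub]
          ring
      · exact ⟨0, by simp, fun t _ => by rw [hmul, jacobiInt_odd_pow _ hb]; simp⟩
  obtain ⟨-, q, hq, hqe⟩ := key _ (hF.comp_chord θ)
  refine ⟨q, hq, ?_, fun t ht => ?_⟩
  · rw [← hqe 1 (by norm_num), ← jacobiInt_const_mul]
    simp [chord]
  · rw [radon_eq_jacobiInt μ F θ ht, ← hqe t (Set.Ioo_subset_Icc_self ht)]
    ring

open Polynomial in
/-- Integration of a polynomial against ridge functions is integration of their profiles against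
the polynomial of Marr's theorem. -/
theorem integral_poly_mul_ridge {μ : ℝ} (hμ : 0 ≤ μ) {n : ℕ} {F : ℝ × ℝ → ℝ} (hF : IsPoly n F)
    (θ : ℝ) : ∃ q : ℝ[X], q.natDegree ≤ n ∧
      q.eval 1 = F (Real.cos θ, Real.sin θ) * jacobiInt (μ - 1 / 2) (μ - 1 / 2) (fun _ => 1) ∧
      ∀ g : ℝ → ℝ, Continuous g →
        ∫ p, F p * g (p.1 * Real.cos θ + p.2 * Real.sin θ) ∂(diskMeasure μ) =
          aConst μ * jacobiInt μ μ fun t => q.eval t * g t := by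
  obtain ⟨q, hq, hq1, hqr⟩ := exists_radon_poly hμ hF θ
  refine ⟨q, hq, hq1, fun g hg => ?_⟩
  rw [← (radon_ridge_fubini hμ (integrable_of_continuous hμ hF.continuous) hg θ).2, jacobiInt,
    integral_Icc_eq_integral_Ioo]
  congr 1
  refine setIntegral_congr_fun measurableSet_Ioo fun t ht => ?_
  simp only [hqr t ht]
  ring

/-- The total mass of the disk, computed along chords. -/
theorem aConst_mul_jacobiInt {μ : ℝ} (hμ : 0 ≤ μ) :
    aConst μ * (jacobiInt (μ - 1 / 2) (μ - 1 / 2) (fun _ => 1) * jacobiInt μ μ fun _ => 1) = 1 := by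
  have h := (radon_ridge_fubini hμ (integrable_of_continuous hμ
    (continuous_const : Continuous fun _ : ℝ × ℝ => (1 : ℝ))) (g := fun _ => 1) continuous_const 0).2
  rw [integral_diskMeasure hμ] at h
  simp only [mul_one, one_mul, (integrableOn_weight hμ).2] at h
  refine Eq.trans ?_ h
  rw [integral_Icc_eq_integral_Ioo, jacobiInt.eq_def μ μ, ← integral_const_mul]
  congr 1
  refine setIntegral_congr_fun measurableSet_Ioo fun t ht => ?_
  simp only [radon_eq_jacobiInt μ _ 0 ht]
  ring

/-- Ridge polynomials of Gegenbauer profile are orthogonal to all polynomials of lower degree. -/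
theorem integral_mul_gegenbauer_ridge_eq_zero {μ : ℝ} (hμ : 0 ≤ μ) {n k : ℕ} (hn : n < k)
    {F : ℝ × ℝ → ℝ} (hF : IsPoly n F) (θ : ℝ) :
    ∫ p, F p * gegenbauer (μ + 1 / 2) k (p.1 * Real.cos θ + p.2 * Real.sin θ) ∂(diskMeasure μ)
      = 0 := by
  obtain ⟨q, hq, -, hqg⟩ := integral_poly_mul_ridge hμ hF θ
  rw [hqg _ (continuous_gegenbauer _ _)]
  have h := jacobiInt_gegenbauer_mul_eval_eq_zero (by positivity : 0 < μ + 1 / 2) q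
    (hq.trans_lt hn)
  rw [add_sub_cancel_right] at h
  simp_rw [mul_comm (q.eval _)]
  rw [h, mul_zero]

/-- On `V_k²(W_μ)`, integration against a ridge polynomial of Gegenbauer profile is a multiple of
the evaluation at the corresponding point of the unit circle. -/
theorem integral_mul_gegenbauer_ridge {μ : ℝ} (hμ : 0 ≤ μ) {k : ℕ} {F : ℝ × ℝ → ℝ}
    (hF : IsPoly k F)
    (hort : ∀ n < k, ∀ G, IsPoly n G → ∫ p, F p * G p ∂(diskMeasure μ) = 0) (θ : ℝ) :
    ∫ p, F p * gegenbauer (μ + 1 / 2) k (p.1 * Real.cos θ + p.2 * Real.sin θ) ∂(diskMeasure μ)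
      = (μ + 1 / 2) / (k + μ + 1 / 2) * F (Real.cos θ, Real.sin θ) := by
  obtain ⟨q, hq, hq1, hqg⟩ := integral_poly_mul_ridge hμ hF θ
  have h := jacobiInt_mul_gegenbauer_of_orthogonal (by positivity : 0 < μ + 1 / 2) q hq (by
    intro p hp
    rw [add_sub_cancel_right]
    have h1 : IsPoly 1 fun z => z.1 * Real.cos θ + z.2 * Real.sin θ := by
      simpa [mul_comm] using
        (IsPoly.fst.const_mul (Real.cos θ)).add (IsPoly.snd.const_mul (Real.sin θ))
    have h2 := hort _ hp _ (by simpa using IsPoly.eval p le_rfl h1)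
    rw [hqg (fun t => p.eval t) (by fun_prop)] at h2
    exact (mul_eq_zero.1 h2).resolve_left (aConst_pos hμ).ne')
  rw [add_sub_cancel_right] at h
  rw [hqg _ (continuous_gegenbauer _ _), h, hq1]
  have h3 := aConst_mul_jacobiInt hμ
  rw [add_assoc]
  linear_combination ((μ + 1 / 2) / (k + (μ + 1 / 2)) * F (Real.cos θ, Real.sin θ)) * h3

/-! ### Discrete orthogonality -/

/-- Here `e^{2πiz/(2m+1)}` is a `(2m+1)`-st root of unity different from `1`: a nonzero even
multiple of `2m + 1` exceeds `4m`. -/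
theorem sum_exp_angle (m : ℕ) {z : ℤ} (hz0 : z ≠ 0) (hz2 : 2 ∣ z) (hz : |z| ≤ 4 * m) :
    ∑ ν ∈ Finset.range (2 * m + 1), Complex.exp (((z * angle m ν : ℝ) : ℂ) * Complex.I) = 0 := by
  have hN : ((2 * m + 1 : ℕ) : ℂ) ≠ 0 := Nat.cast_ne_zero.2 (by omega)
  have hpi : (2 * Real.pi * Complex.I : ℂ) ≠ 0 := Complex.two_pi_I_ne_zero
  set ζ := Complex.exp (z / (2 * m + 1 : ℕ) * (2 * Real.pi * Complex.I)) with hζ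
  have hpow : ∀ ν : ℕ, Complex.exp (((z * angle m ν : ℝ) : ℂ) * Complex.I) = ζ ^ ν := by
    intro ν
    rw [hζ, ← Complex.exp_nat_mul]
    congr 1
    simp only [angle]
    push_cast
    ring
  simp_rw [hpow]
  have h1 : ζ ≠ 1 := by
    intro h
    obtain ⟨n, hn⟩ := Complex.exp_eq_one_iff.1 h
    have hn' := mul_right_cancel₀ hpi hn
    rw [div_eq_iff hN] at hn'
    have hn2 : z = n * (2 * m + 1 : ℕ) := by exact_mod_cast hn'
    -- `z` is even and `2m + 1` is odd, so that `n` is even and `|z| ≥ 2 (2m + 1)`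
    have hev : (2 : ℤ) ∣ n := by
      have h2 : z = 2 * (n * m) + n := by rw [hn2]; push_cast; ring
      exact (Int.dvd_add_right (dvd_mul_right 2 (n * m))).1 (h2 ▸ hz2)
    obtain ⟨c, rfl⟩ := hev
    have hc : c ≠ 0 := by rintro rfl; simp at hn2; exact hz0 hn2
    have hc1 : 1 ≤ |c| := Int.one_le_abs hc
    rw [hn2, abs_mul, abs_mul, Nat.abs_cast] at hz
    push_cast at hz
    rw [abs_two] at hz
    nlinarith
  have h2 : ζ ^ (2 * m + 1) = 1 := by
    rw [hζ, ← Complex.exp_nat_mul, ← mul_assoc, mul_div_cancel₀ _ hN]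
    exact Complex.exp_int_mul_two_pi_mul_I z
  have h3 := mul_geom_sum ζ (2 * m + 1)
  rw [h2, sub_self] at h3
  exact (mul_eq_zero.1 h3).resolve_left (sub_ne_zero.2 h1)

theorem sum_cos_angle (m : ℕ) {z : ℤ} (hz2 : 2 ∣ z) (hz : |z| ≤ 4 * m) :
    ∑ ν ∈ Finset.range (2 * m + 1), Real.cos (z * angle m ν) =
      if z = 0 then (2 * m + 1 : ℝ) else 0 := by
  split_ifs with h
  · simp [h]
  · have := congrArg Complex.re (sum_exp_angle m h hz2 hz)
    simpa only [Complex.re_sum, Complex.exp_ofReal_mul_I_re, Complex.zero_re] using this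

theorem sum_sin_angle (m : ℕ) {z : ℤ} (hz2 : 2 ∣ z) (hz : |z| ≤ 4 * m) :
    ∑ ν ∈ Finset.range (2 * m + 1), Real.sin (z * angle m ν) = 0 := by
  by_cases h : z = 0
  · simp [h]
  · have := congrArg Complex.im (sum_exp_angle m h hz2 hz)
    simpa only [Complex.im_sum, Complex.exp_ofReal_mul_I_im, Complex.zero_im] using this

/-- `S_{j,ε}(φ)`. -/
def trig (ε : Fin 2) (j : ℕ) (φ : ℝ) : ℝ := if ε = 0 then Real.cos (j * φ) else Real.sin (j * φ)

/-- The pairs `(l, ε)` that index the basis of `V_k²(W_μ)`: `ε = 0` with `2l ≤ k` and `ε = 1` with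
`2l < k`. -/
abbrev BasisIndex (k : ℕ) : Type := Fin (k / 2 + 1) ⊕ Fin ((k + 1) / 2)

/-- The component `l` of an index. -/
def BasisIndex.l {k : ℕ} : BasisIndex k → ℕ
  | Sum.inl a => a
  | Sum.inr a => a

/-- The component `ε` of an index. -/
def BasisIndex.ε {k : ℕ} : BasisIndex k → Fin 2
  | Sum.inl _ => 0
  | Sum.inr _ => 1

theorem BasisIndex.two_mul_l_le {k : ℕ} (i : BasisIndex k) : 2 * i.l ≤ k := by
  rcases i with a | a <;> simp only [BasisIndex.l] <;> omega

theorem card_basisIndex (k : ℕ) : Fintype.card (BasisIndex k) = k + 1 := by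
  simp only [Fintype.card_sum, Fintype.card_fin]; omega

theorem dConst_pos (k l : ℕ) : 0 < dConst k l := by
  unfold dConst; split_ifs <;> norm_num

/-- On `2m + 1` equidistant angles, the trigonometric functions of degree at most `2m` and of the
same parity are orthogonal. -/
theorem sum_trig_mul_trig {m k : ℕ} (hk : k ≤ 2 * m) (i i' : BasisIndex k) :
    ∑ ν ∈ Finset.range (2 * m + 1),
      trig i.ε (k - 2 * i.l) (angle m ν) * trig i'.ε (k - 2 * i'.l) (angle m ν) =
      if i = i' then (2 * m + 1) * dConst k i.l else 0 := by
  have hj := i.two_mul_l_le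
  have hj' := i'.two_mul_l_le
  obtain ⟨j, hje⟩ : ∃ j, j = k - 2 * i.l := ⟨_, rfl⟩
  obtain ⟨j', hje'⟩ : ∃ j, j = k - 2 * i'.l := ⟨_, rfl⟩
  have hs2 : (2 : ℤ) ∣ (j : ℤ) + j' := by omega
  have hd2 : (2 : ℤ) ∣ (j : ℤ) - j' := by omega
  have hs : |(j : ℤ) + j'| ≤ 4 * m := by rw [abs_le]; omega
  have hd : |(j : ℤ) - j'| ≤ 4 * m := by rw [abs_le]; omega
  have c1 := sum_cos_angle m hs2 hs
  have c2 := sum_cos_angle m hd2 hd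
  have s1 := sum_sin_angle m hs2 hs
  have s2 := sum_sin_angle m hd2 hd
  push_cast at c1 c2 s1 s2
  rw [← hje, ← hje']
  rcases i with a | a <;> rcases i' with b | b <;>
    simp only [BasisIndex.l, BasisIndex.ε, trig, if_true, Sum.inl.injEq,
      Sum.inr.injEq, one_ne_zero, if_false, reduceCtorEq, Fin.ext_iff] at hje hje' hj hj' ⊢
  · have : ∀ ν, Real.cos (j * angle m ν) * Real.cos (j' * angle m ν) =
        1 / 2 * (Real.cos ((j + j') * angle m ν) + Real.cos ((j - j') * angle m ν)) := by
      intro ν; rw [add_mul, sub_mul, Real.cos_add, Real.cos_sub]; ring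
    simp_rw [this]
    rw [← Finset.mul_sum, Finset.sum_add_distrib, c1, c2, dConst]
    split_ifs <;> first | omega | ring
  · have : ∀ ν, Real.cos (j * angle m ν) * Real.sin (j' * angle m ν) =
        1 / 2 * (Real.sin ((j + j') * angle m ν) - Real.sin ((j - j') * angle m ν)) := by
      intro ν; rw [add_mul, sub_mul, Real.sin_add, Real.sin_sub]; ring
    simp_rw [this]
    rw [← Finset.mul_sum, Finset.sum_sub_distrib, s1, s2]; simp
  · have : ∀ ν, Real.sin (j * angle m ν) * Real.cos (j' * angle m ν) =
        1 / 2 * (Real.sin ((j + j') * angle m ν) + Real.sin ((j - j') * angle m ν)) := by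
      intro ν; rw [add_mul, sub_mul, Real.sin_add, Real.sin_sub]; ring
    simp_rw [this]
    rw [← Finset.mul_sum, Finset.sum_add_distrib, s1, s2]; simp
  · have : ∀ ν, Real.sin (j * angle m ν) * Real.sin (j' * angle m ν) =
        1 / 2 * (Real.cos ((j - j') * angle m ν) - Real.cos ((j + j') * angle m ν)) := by
      intro ν; rw [add_mul, sub_mul, Real.cos_add, Real.cos_sub]; ring
    simp_rw [this]
    rw [← Finset.mul_sum, Finset.sum_sub_distrib, c1, c2, dConst]
    split_ifs <;> first | omega | ring

/-! ### The kernel -/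

theorem jacobi_one_ne_zero {α : ℝ} (hα : -1 < α) (β : ℝ) (n : ℕ) : jacobi α β n 1 ≠ 0 := by
  rw [jacobi_one]
  exact (div_pos (poch_pos (by linarith) n) (by positivity)).ne'

theorem harmonic_circle (ε : Fin 2) (j : ℕ) (φ : ℝ) :
    harmonic ε j (Real.cos φ) (Real.sin φ) = trig ε j φ := by
  simpa [trig] using harmonic_polar ε j 1 φ

theorem discPoly_circle {μ : ℝ} (hμ : 0 ≤ μ) (j l : ℕ) (ε : Fin 2) (φ : ℝ) :
    discPoly μ j l ε (Real.cos φ, Real.sin φ) = trig ε j φ := by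
  rw [discPoly, harmonic_circle]
  simp only [Real.cos_sq_add_sin_sq]
  rw [show (2 : ℝ) * 1 - 1 = 1 by norm_num, div_self (jacobi_one_ne_zero (by linarith) _ _), one_mul]

/-- The normalizing constants of the basis cancel in `λ_{l,k} P_{l,ε}(ξ) P_{l,ε}(x, y)`. -/
theorem ridge_term {μ : ℝ} (hμ : 0 ≤ μ) (k l : ℕ) (ε : Fin 2) (ξ x y : ℝ) :
    (HConst μ k l ^ 2)⁻¹ * (basisPoly μ k l ε (Real.cos ξ) (Real.sin ξ) * basisPoly μ k l ε x y) =
      (dConst k l)⁻¹ * trig ε (k - 2 * l) ξ * discPoly μ (k - 2 * l) l ε (x, y) := by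
  have hn := Nat.cast_nonneg (α := ℝ) (k - 2 * l)
  have h1 : hConst μ k l ≠ 0 := by
    refine (Real.sqrt_pos.2 (div_pos (Real.Gamma_pos_of_pos (by positivity))
      (mul_pos (Real.Gamma_pos_of_pos (by positivity)) (Real.Gamma_pos_of_pos (by positivity))))).ne'
  have h2 := (Real.sqrt_pos.2 (jacobiMean_jacobi_sq_pos (α := μ - 1 / 2) (β := (k - 2 * l : ℕ))
    (by linarith) (by linarith) (by linarith) l)).ne'
  have h3 := jacobi_one_ne_zero (by linarith : -1 < μ - 1 / 2) (k - 2 * l : ℕ) l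
  have h4 := Real.sq_sqrt (dConst_pos k l).le
  have h5 := (Real.sqrt_pos.2 (dConst_pos k l)).ne'
  simp only [HConst, basisPoly, jacobiON, discPoly, harmonic_circle, Real.cos_sq_add_sin_sq]
  rw [show (2 : ℝ) * 1 - 1 = 1 by norm_num]
  rw [← h4, Real.sqrt_sq (Real.sqrt_nonneg _)]
  generalize √(dConst k l) = d at *
  generalize √(jacobiMean (μ - 1 / 2) (k - 2 * l : ℕ) _) = N at *
  field_simp

theorem ridgeKernel_eq {μ : ℝ} (hμ : 0 ≤ μ) (k : ℕ) (ξ x y : ℝ) :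
    ridgeKernel μ k ξ x y = ∑ i : BasisIndex k, (dConst k i.l)⁻¹ * trig i.ε (k - 2 * i.l) ξ *
      discPoly μ (k - 2 * i.l) i.l i.ε (x, y) := by
  have f1 : (Finset.range (k + 1)).filter (fun l => 2 * l ≤ k) = Finset.range (k / 2 + 1) := by
    ext l; simp only [Finset.mem_filter, Finset.mem_range]; omega
  have f2 : (Finset.range (k + 1)).filter (fun l => 2 * l < k) = Finset.range ((k + 1) / 2) := by
    ext l; simp only [Finset.mem_filter, Finset.mem_range]; omega
  rw [ridgeKernel, f1, f2, Fintype.sum_sum_type, Finset.sum_range, Finset.sum_range]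
  simp_rw [ridge_term hμ]
  rfl

/-! ### Reproduction of the orthogonal polynomials from their values on the circle -/

/-- `⟨·, ·⟩_μ` is definite on polynomials. -/
theorem eq_zero_of_integral_sq {μ : ℝ} (hμ : 0 ≤ μ) (P : MvPolynomial (Fin 2) ℝ)
    (h : ∫ p, polyFun P p * polyFun P p ∂(diskMeasure μ) = 0) : P = 0 := by
  have hc : Continuous (polyFun P) := IsPoly.continuous ⟨P, le_rfl, fun _ => rfl⟩
  have hi : Integrable (fun p => polyFun P p * polyFun P p) (diskMeasure μ) :=
    integrable_of_continuous hμ (hc.mul hc)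
  rw [integral_diskMeasure hμ] at h
  have h := (mul_eq_zero.1 h).resolve_left (aConst_pos hμ).ne'
  rw [setIntegral_eq_zero_iff_of_nonneg_ae ?_ ((integrable_diskMeasure_iff hμ _).1 hi)] at h
  · set U : Set (ℝ × ℝ) := {p | p.1 ^ 2 + p.2 ^ 2 < 1} with hU
    have hUo : IsOpen U := isOpen_lt (by fun_prop) (by fun_prop)
    have hUd : U ⊆ disk := fun p hp => le_of_lt (show p.1 ^ 2 + p.2 ^ 2 < 1 from hp)
    have h2 : polyFun P =ᵐ[volume.restrict U] fun _ => 0 := by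
      filter_upwards [ae_restrict_of_ae_restrict_of_subset hUd h,
        ae_restrict_mem hUo.measurableSet] with p hp hpU
      have hw : 0 < weight μ p := Real.rpow_pos_of_pos (by
        have : p.1 ^ 2 + p.2 ^ 2 < 1 := hpU
        linarith) _
      simpa [hw.ne'] using hp
    have h3 := Measure.eqOn_open_of_ae_eq h2 hUo hc.continuousOn continuousOn_const
    refine MvPolynomial.funext_set (fun _ => Set.Ioo (0 : ℝ) (1 / 2))
      (fun _ => Set.Ioo_infinite (by norm_num)) fun x hx => ?_
    have hx0 := hx 0 (Set.mem_univ _)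
    have hx1 := hx 1 (Set.mem_univ _)
    have hxU : (x 0, x 1) ∈ U := by
      simp only [hU, Set.mem_ofPred_eq]
      nlinarith [hx0.1, hx0.2, hx1.1, hx1.2]
    have h4 := h3 hxU
    have h5 : ![x 0, x 1] = x := by ext i; fin_cases i <;> rfl
    simpa [polyFun, h5] using h4
  · filter_upwards [ae_restrict_mem measurableSet_disk] with p hp
    exact mul_nonneg (mul_self_nonneg _) (weight_nonneg μ hp)

/-- `V_k²(W_μ)` as a space of polynomials. -/
def orthPolySpace {μ : ℝ} (hμ : 0 ≤ μ) (k : ℕ) : Submodule ℝ (MvPolynomial (Fin 2) ℝ) where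
  carrier := {P | P.totalDegree ≤ k ∧
    ∀ n < k, ∀ G, IsPoly n G → ∫ p, polyFun P p * G p ∂(diskMeasure μ) = 0}
  zero_mem' := ⟨by simp, fun n _ G _ => by simp [polyFun]⟩
  add_mem' := by
    rintro P Q ⟨hP, hP0⟩ ⟨hQ, hQ0⟩
    refine ⟨(MvPolynomial.totalDegree_add _ _).trans (max_le hP hQ), fun n hn G hG => ?_⟩
    have cP : Continuous (polyFun P) := IsPoly.continuous ⟨P, le_rfl, fun _ => rfl⟩
    have cQ : Continuous (polyFun Q) := IsPoly.continuous ⟨Q, le_rfl, fun _ => rfl⟩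
    have h1 : Integrable (fun p => polyFun P p * G p) (diskMeasure μ) :=
      integrable_of_continuous hμ (cP.mul hG.continuous)
    have h2 : Integrable (fun p => polyFun Q p * G p) (diskMeasure μ) :=
      integrable_of_continuous hμ (cQ.mul hG.continuous)
    have h3 := integral_add h1 h2
    rw [hP0 n hn G hG, hQ0 n hn G hG, add_zero] at h3
    rw [← h3]
    congr 1
    funext p
    simp [polyFun, add_mul]
  smul_mem' := by
    rintro c P ⟨hP, hP0⟩
    refine ⟨(MvPolynomial.totalDegree_smul_le _ _).trans hP, fun n hn G hG => ?_⟩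
    have h3 := integral_const_mul (μ := diskMeasure μ) c (fun p => polyFun P p * G p)
    rw [hP0 n hn G hG, mul_zero] at h3
    rw [← h3]
    congr 1
    funext p
    simp [polyFun, MvPolynomial.smul_eval, mul_assoc]

/-- The coefficients of the terms of degree `k`. -/
def leadingCoeffs {μ : ℝ} (hμ : 0 ≤ μ) (k : ℕ) : orthPolySpace hμ k →ₗ[ℝ] (Fin (k + 1) → ℝ) :=
  LinearMap.pi fun a => (MvPolynomial.lcoeff ℝ
    (Finsupp.single 0 (a : ℕ) + Finsupp.single 1 (k - a : ℕ))).comp (orthPolySpace hμ k).subtype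

/-- An element of `V_k²(W_μ)` without terms of degree `k` is orthogonal to itself. -/
theorem leadingCoeffs_injective {μ : ℝ} (hμ : 0 ≤ μ) (k : ℕ) :
    Function.Injective (leadingCoeffs hμ k) := by
  rw [injective_iff_map_eq_zero]
  rintro ⟨P, hP, hP0⟩ h
  have hcoeff : ∀ d : Fin 2 →₀ ℕ, d 0 + d 1 = k → P.coeff d = 0 := by
    intro d hd
    have h1 := congrFun h ⟨d 0, by omega⟩
    have h2 : Finsupp.single 0 (d 0) + Finsupp.single 1 (k - d 0) = d := by
      ext i
      fin_cases i
      · simp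
      · simp; omega
    simp only [leadingCoeffs, LinearMap.pi_apply, LinearMap.comp_apply, Submodule.subtype_apply,
      MvPolynomial.lcoeff_apply, Pi.zero_apply] at h1
    rwa [h2] at h1
  refine Subtype.ext ?_
  change P = 0
  rcases Nat.eq_zero_or_pos k with rfl | hk
  · rw [MvPolynomial.totalDegree_eq_zero_iff_eq_C.1 (Nat.le_zero.1 hP), hcoeff 0 (by simp), map_zero]
  · refine eq_zero_of_integral_sq hμ P (hP0 (k - 1) (by omega) _ ⟨P, ?_, fun _ => rfl⟩)
    refine Finset.sup_le fun d hd => ?_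
    have h3 := IsPoly.degree_le_of_mem_support hd
    have h4 : d 0 + d 1 ≠ k := fun h => MvPolynomial.mem_support_iff.1 hd (hcoeff d h)
    rw [Finsupp.sum_fintype _ _ (fun _ => rfl), Fin.sum_univ_two]
    omega

instance {μ : ℝ} (hμ : 0 ≤ μ) (k : ℕ) : FiniteDimensional ℝ (orthPolySpace hμ k) :=
  FiniteDimensional.of_injective _ (leadingCoeffs_injective hμ k)

/-- The discrete Fourier coefficients of the restriction to the unit circle. -/
def circleCoeff {μ : ℝ} (hμ : 0 ≤ μ) (k m : ℕ) (i : BasisIndex k) :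
    orthPolySpace hμ k →ₗ[ℝ] ℝ where
  toFun P := 1 / (2 * (m : ℝ) + 1) * ∑ ν ∈ Finset.range (2 * m + 1),
    polyFun P (Real.cos (angle m ν), Real.sin (angle m ν)) *
      ((dConst k i.l)⁻¹ * trig i.ε (k - 2 * i.l) (angle m ν))
  map_add' P Q := by
    rw [← mul_add, ← Finset.sum_add_distrib]
    simp [polyFun, add_mul]
  map_smul' c P := by
    rw [RingHom.id_apply, smul_eq_mul, mul_left_comm c]
    congr 1
    rw [Finset.mul_sum]
    simp [polyFun, MvPolynomial.smul_eval, mul_assoc]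

/-- The elements of `V_k²(W_μ)` are determined by their values at `2m + 1 > k` equidistant points of
the unit circle. -/
theorem sum_circle_mul_ridgeKernel {μ : ℝ} (hμ : 0 ≤ μ) {m k : ℕ} (hk : k ≤ 2 * m)
    (P : orthPolySpace hμ k) (x y : ℝ) :
    1 / (2 * (m : ℝ) + 1) * ∑ ν ∈ Finset.range (2 * m + 1),
      polyFun P (Real.cos (angle m ν), Real.sin (angle m ν)) * ridgeKernel μ k (angle m ν) x y =
      polyFun P (x, y) := by
  have hB : ∀ i : BasisIndex k, ∃ B : orthPolySpace hμ k,
      ∀ p, discPoly μ (k - 2 * i.l) i.l i.ε p = polyFun B p := by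
    intro i
    have hi := i.two_mul_l_le
    obtain ⟨B, hBd, hBe⟩ := isPoly_discPoly μ (k - 2 * i.l) i.l i.ε
    refine ⟨⟨B, hBd.trans (by omega), fun n hn G hG => ?_⟩, hBe⟩
    simp_rw [← hBe]
    exact integral_discPoly_mul hμ _ _ _ (by omega) hG
  choose B hBe using hB
  have hN : (2 * (m : ℝ) + 1) ≠ 0 := by positivity
  have hdual : ∀ i i', circleCoeff hμ k m i (B i') = if i' = i then 1 else 0 := by
    intro i i'
    have h := sum_trig_mul_trig hk i' i
    simp only [circleCoeff, LinearMap.coe_mk, AddHom.coe_mk, ← hBe, discPoly_circle hμ]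
    simp_rw [mul_left_comm _ (dConst k i.l)⁻¹]
    rw [← Finset.mul_sum, h]
    have := (dConst_pos k i.l).ne'
    split_ifs with hii
    · subst hii
      field_simp
    · simp
  have hli : LinearIndependent ℝ B := LinearIndependent.of_pairwise_dual_eq_zero_one B
    (circleCoeff hμ k m) (fun i i' hii => (hdual i i').trans (if_neg hii.symm))
    (fun i => by rw [hdual, if_pos rfl])
  have hspan : Submodule.span ℝ (Set.range B) = ⊤ := by
    refine hli.span_eq_top_of_card_eq_finrank' (le_antisymm hli.fintype_card_le_finrank ?_)
    rw [card_basisIndex]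
    simpa using LinearMap.finrank_le_finrank_of_injective (leadingCoeffs_injective hμ k)
  have hrec : (∑ i, (circleCoeff hμ k m i).smulRight (B i)) = LinearMap.id := by
    refine LinearMap.ext_on_range hspan fun i' => ?_
    simp only [LinearMap.sum_apply, LinearMap.smulRight_apply, hdual, ite_smul, one_smul, zero_smul,
      Finset.sum_ite_eq, Finset.mem_univ, if_true, LinearMap.id_apply]
  have hP := congrArg (fun L : orthPolySpace hμ k →ₗ[ℝ] orthPolySpace hμ k =>
    polyFun (L P : MvPolynomial (Fin 2) ℝ) (x, y)) hrec
  simp only [LinearMap.id_apply] at hP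
  rw [← hP]
  have hlin : polyFun (((∑ i, (circleCoeff hμ k m i).smulRight (B i)) P : orthPolySpace hμ k) :
      MvPolynomial (Fin 2) ℝ) (x, y) = ∑ i, circleCoeff hμ k m i P * polyFun (B i) (x, y) := by
    simp [polyFun, LinearMap.sum_apply, MvPolynomial.smul_eval]
  rw [hlin]
  simp only [circleCoeff, LinearMap.coe_mk, AddHom.coe_mk, ridgeKernel_eq hμ, ← hBe]
  simp_rw [Finset.mul_sum, Finset.sum_mul]
  rw [Finset.sum_comm]
  exact Finset.sum_congr rfl fun i _ => Finset.sum_congr rfl fun ν _ => by ring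

/-! ### The projection -/

theorem toLp_mem_polyL2 {μ : ℝ} {n : ℕ} {G : ℝ × ℝ → ℝ} (hG : IsPoly n G)
    (hm : MemLp G 2 (diskMeasure μ)) : hm.toLp G ∈ polyL2 μ n := by
  obtain ⟨Q, hQ, hGQ⟩ := hG
  refine ⟨Q, (MvPolynomial.mem_restrictTotalDegree _ _ _).2 hQ, ?_⟩
  filter_upwards [hm.coeFn_toLp] with p hp
  rw [hp, hGQ]

theorem isPoly_gegenbauer_ridge (lam : ℝ) (k : ℕ) (θ : ℝ) :
    IsPoly k fun p => gegenbauer lam k (p.1 * Real.cos θ + p.2 * Real.sin θ) := by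
  obtain ⟨g, hgd, hg⟩ := exists_gegenbauer_poly lam k
  have h1 : IsPoly 1 fun z => z.1 * Real.cos θ + z.2 * Real.sin θ := by
    simpa [mul_comm] using
      (IsPoly.fst.const_mul (Real.cos θ)).add (IsPoly.snd.const_mul (Real.sin θ))
  simpa [hg] using IsPoly.eval g hgd h1

/-- Ridge polynomials of Gegenbauer profile do not distinguish `f` from its projection. -/
theorem integral_proj_mul_gegenbauer_ridge {μ : ℝ} (hμ : 0 ≤ μ) (k : ℕ) {f : ℝ × ℝ → ℝ}
    (hf : MemLp f 2 (diskMeasure μ)) (P : MvPolynomial (Fin 2) ℝ)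
    (hP : (orthPoly μ k).starProjection (hf.toLp f) =ᵐ[diskMeasure μ] polyFun P) (θ : ℝ) :
    ∫ p, f p * gegenbauer (μ + 1 / 2) k (p.1 * Real.cos θ + p.2 * Real.sin θ) ∂(diskMeasure μ) =
    ∫ p, polyFun P p * gegenbauer (μ + 1 / 2) k (p.1 * Real.cos θ + p.2 * Real.sin θ)
      ∂(diskMeasure μ) := by
  set g : ℝ × ℝ → ℝ := fun p => gegenbauer (μ + 1 / 2) k (p.1 * Real.cos θ + p.2 * Real.sin θ)
  have hg : IsPoly k g := isPoly_gegenbauer_ridge _ _ _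
  have hgm : MemLp g 2 (diskMeasure μ) := memLp_of_continuous hμ hg.continuous 2
  have hmem : hgm.toLp g ∈ orthPoly μ k := by
    refine Submodule.mem_inf.2 ⟨toLp_mem_polyL2 hg hgm, (Submodule.mem_iInf _).2 fun n => ?_⟩
    rw [Submodule.mem_orthogonal]
    rintro h ⟨Q, hQ, hhQ⟩
    rw [L2.inner_def, ← integral_mul_gegenbauer_ridge_eq_zero hμ n.2
      ⟨Q, (MvPolynomial.mem_restrictTotalDegree _ _ _).1 hQ, fun _ => rfl⟩ θ]
    refine integral_congr_ae ?_
    filter_upwards [hhQ, hgm.coeFn_toLp] with p h1 h2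
    rw [h1, h2]
    simp [g, mul_comm]
  have h := Submodule.starProjection_inner_eq_zero (K := orthPoly μ k) (hf.toLp f) _ hmem
  rw [inner_sub_left, sub_eq_zero, L2.inner_def, L2.inner_def] at h
  have e1 : ∫ p, f p * g p ∂(diskMeasure μ) =
      ∫ p, inner ℝ (hf.toLp f p) (hgm.toLp g p) ∂(diskMeasure μ) := by
    refine integral_congr_ae ?_
    filter_upwards [hf.coeFn_toLp, hgm.coeFn_toLp] with p h1 h2
    rw [h1, h2]
    simp [mul_comm]
  have e2 : ∫ p, polyFun P p * g p ∂(diskMeasure μ) = ∫ p, inner ℝ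
      ((orthPoly μ k).starProjection (hf.toLp f) p) (hgm.toLp g p) ∂(diskMeasure μ) := by
    refine integral_congr_ae ?_
    filter_upwards [hP, hgm.coeFn_toLp] with p h1 h2
    rw [h1, h2]
    simp [mul_comm]
  rw [e1, e2, h]

theorem mem_orthPolySpace_of_mem_orthPoly {μ : ℝ} (hμ : 0 ≤ μ) {k : ℕ}
    {h : Lp ℝ 2 (diskMeasure μ)} (hh : h ∈ orthPoly μ k) {P : MvPolynomial (Fin 2) ℝ}
    (hPd : P ∈ MvPolynomial.restrictTotalDegree (Fin 2) ℝ k)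
    (hP : h =ᵐ[diskMeasure μ] polyFun P) : P ∈ orthPolySpace hμ k := by
  refine ⟨(MvPolynomial.mem_restrictTotalDegree _ _ _).1 hPd, fun n hn G hG => ?_⟩
  have hGm : MemLp G 2 (diskMeasure μ) := memLp_of_continuous hμ hG.continuous 2
  have h1 := (Submodule.mem_iInf _).1 (Submodule.mem_inf.1 hh).2 ⟨n, hn⟩
  have h2 := (Submodule.mem_orthogonal _ _).1 h1 _ (toLp_mem_polyL2 hG hGm)
  rw [L2.inner_def] at h2
  rw [← h2]
  refine integral_congr_ae ?_
  filter_upwards [hP, hGm.coeFn_toLp] with p h3 h4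
  rw [h3, h4]
  simp

end AttenuatedRadon

end

theorem theorem2p9 (μ : ℝ) (hμ : 0 ≤ μ) (m k : ℕ) (hk : k ≤ 2 * m) (f : ℝ × ℝ → ℝ)
    (hf : MemLp f 2 (AttenuatedRadon.diskMeasure μ)) :
    (∀ θ : ℝ,
      (∀ᵐ t ∂(volume.restrict (Set.Icc (-1 : ℝ) 1)), IntervalIntegrable
        (AttenuatedRadon.radonIntegrand μ f θ t) volume (-√(1 - t ^ 2)) √(1 - t ^ 2)) ∧
      ∀ x y : ℝ, IntervalIntegrable
        (fun t => AttenuatedRadon.radon μ f θ t * AttenuatedRadon.dKernel μ k θ t x y)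
        volume (-1) 1) ∧
    ∀ x y : ℝ, AttenuatedRadon.proj μ k (hf.toLp f) x y =
      1 / (2 * (m : ℝ) + 1) * ∑ ν ∈ Finset.range (2 * m + 1),
        AttenuatedRadon.aConst μ * ∫ t in (-1 : ℝ)..1,
          AttenuatedRadon.radon μ f (AttenuatedRadon.angle m ν) t *
            AttenuatedRadon.dKernel μ k (AttenuatedRadon.angle m ν) t x y := by
  open AttenuatedRadon in
  have := isFiniteMeasure_diskMeasure hμ
  have hfi : Integrable f (diskMeasure μ) := hf.integrable (by norm_num)
  have hdc : ∀ θ x y, Continuous fun t => dKernel μ k θ t x y := fun θ x y =>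
    (continuous_const.mul (continuous_gegenbauer _ _)).mul continuous_const
  refine ⟨fun θ => ⟨(radon_fubini μ θ ((integrable_diskMeasure_iff hμ f).1 hfi)).1, fun x y => ?_⟩,
    fun x y => ?_⟩
  · rw [intervalIntegrable_iff_integrableOn_Icc_of_le (by norm_num)]
    exact (radon_ridge_fubini hμ hfi (hdc θ x y) θ).1
  obtain ⟨hPd, hP⟩ := (exists_poly_proj μ k (hf.toLp f)).choose_spec
  set P := (exists_poly_proj μ k (hf.toLp f)).choose
  have hPmem : P ∈ orthPolySpace hμ k :=
    mem_orthPolySpace_of_mem_orthPoly hμ (Submodule.starProjection_apply_mem _ _) hPd hP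
  have hterm : ∀ θ, aConst μ * ∫ t in (-1 : ℝ)..1, radon μ f θ t * dKernel μ k θ t x y =
      polyFun P (Real.cos θ, Real.sin θ) * ridgeKernel μ k θ x y := by
    intro θ
    rw [intervalIntegral.integral_of_le (by norm_num), ← integral_Icc_eq_integral_Ioc,
      (radon_ridge_fubini hμ hfi (hdc θ x y) θ).2]
    have h1 : ∀ p : ℝ × ℝ, f p * dKernel μ k θ (p.1 * Real.cos θ + p.2 * Real.sin θ) x y =
        ((k + μ + 1 / 2) / (μ + 1 / 2) * ridgeKernel μ k θ x y) *
          (f p * gegenbauer (μ + 1 / 2) k (p.1 * Real.cos θ + p.2 * Real.sin θ)) := by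
      intro p; rw [dKernel]; ring
    simp_rw [h1]
    rw [integral_const_mul, integral_proj_mul_gegenbauer_ridge hμ k hf P hP,
      integral_mul_gegenbauer_ridge hμ ⟨P, hPmem.1, fun _ => rfl⟩ hPmem.2]
    have h2 : μ + 1 / 2 ≠ 0 := by positivity
    have h3 : (k : ℝ) + μ + 1 / 2 ≠ 0 := by positivity
    field_simp
  simp_rw [hterm]
  exact (sum_circle_mul_ridgeKernel hμ hk ⟨P, hPmem⟩ x y).symm
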